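/- Let $G$ be a finite group and let $V$ be an $n$-dimensional real linear representation of $G$. Let $X$ be either a simplicial complex or a regular simplicial set (a simplicial set in which every non-degenerate simplex is embedded, i.e. its characteristic map from the standard simplex is a monomorphism), equipped with a simplicial action of $G$. Assume that: 1. for every (closed) face $\sigma$ of $X$ and every $g\in G$ with $g\ne e$, the intersection $\sigma\cap g\sigma$ is empty (in particular the action is free); 2. the equivariant Euler class $e(V)\in H^n_G(X;\pm\mathbb Z)$ is non-zero. Here $\pm\mathbb Z = H_n(V,V\setminus\{0\};\mathbb Z)$ is the group of integers on which $g\in G$ acts by the sign of the determinant of its action on $V$; since the action on $X$ is free, $H^n_G(X;\pm\mathbb Z)$ is the cohomology of the complex of $G$-equivariant simplicial cochains of $X$ with values in $\pm\mathbb Z$; and $e(V)$ is the Euler class of the vector bundle $(X\times V)/G\to X/G$, represented by the cocycle that sends an $n$-simplex $\sigma$ to the class of $f|_\sigma$ in $H_n(V,V\setminus\{0\};\mathbb Z)$, where $f\colon X\to V$ is any continuous $G$-equivariant map without zeros on the $(n-1)$-skeleton of $X$. Then $X$ has at least $2^n$ $G$-orbits of faces of dimension $n$ (for a simplicial set: of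 non-degenerate $n$-simplices). -/

import Mathlib

open CategoryTheory Opposite
open scoped Pointwise

universe u v w

noncomputable section

namespace EquivariantEuler

/-! ### Relative singular homology with integer coefficients -/

section Singular

/-- The affine map `Δ^m → Δ^k` of topological standard simplices given by a map of vertices. -/
def simplexMap {m k : ℕ} (θ : Fin (m + 1) → Fin (k + 1)) :
    C(stdSimplex ℝ (Fin (m + 1)), stdSimplex ℝ (Fin (k + 1))) :=
  ⟨stdSimplex.map θ, stdSimplex.continuous_map θ⟩

variable (Y : Type v) [TopologicalSpace Y]

/-- Singular `k`-simplices of `Y`. -/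
abbrev SingularSimplex (k : ℕ) : Type v := C(stdSimplex ℝ (Fin (k + 1)), Y)

/-- Singular `k`-chains of `Y` with integer coefficients. -/
abbrev SingularChain (k : ℕ) : Type v := SingularSimplex Y k →₀ ℤ

/-- The boundary operator `∂ σ = ∑ (-1)^i σ ∘ δ_i` from `(k+1)`-chains to `k`-chains. -/
def boundary (k : ℕ) : SingularChain Y (k + 1) →ₗ[ℤ] SingularChain Y k :=
  Finsupp.linearCombination ℤ fun σ : SingularSimplex Y (k + 1) =>
    ∑ i : Fin (k + 2), ((-1 : ℤ) ^ (i : ℕ)) •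
      Finsupp.single (σ.comp (simplexMap i.succAbove)) (1 : ℤ)

variable {Y}

/-- Singular chains of `Y` supported on simplices contained in the subset `A`. -/
def chainsIn (A : Set Y) (k : ℕ) : Submodule ℤ (SingularChain Y k) :=
  Finsupp.supported ℤ ℤ {σ : SingularSimplex Y k | ∀ p, σ p ∈ A}

/-- Relative cycles of the pair `(Y, A)`: chains whose boundary lies in `A`. -/
def relCycles (A : Set Y) : (k : ℕ) → Submodule ℤ (SingularChain Y k)
  | 0 => ⊤
  | k + 1 => (chainsIn A k).comap (boundary Y k)

/-- Relative boundaries of the pair `(Y, A)`: boundaries of chains in `Y`, plus chains in `A`. -/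
def relBoundaries (A : Set Y) (k : ℕ) : Submodule ℤ (SingularChain Y k) :=
  LinearMap.range (boundary Y k) ⊔ chainsIn A k

/-- The relative singular homology group `H_k(Y, A; ℤ)`. -/
abbrev RelHomology (A : Set Y) (k : ℕ) : Type v :=
  relCycles A k ⧸ (relBoundaries A k).submoduleOf (relCycles A k)

/-- The chain map induced by a continuous self-map of `Y`. -/
def chainMap (φ : C(Y, Y)) (k : ℕ) : SingularChain Y k →ₗ[ℤ] SingularChain Y k :=
  Finsupp.lmapDomain ℤ ℤ fun σ : SingularSimplex Y k => φ.comp σ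

lemma chainMap_boundary (φ : C(Y, Y)) (k : ℕ) (c : SingularChain Y (k + 1)) :
    chainMap φ k (boundary Y k c) = boundary Y k (chainMap φ (k + 1) c) := by
  induction c using Finsupp.induction_linear with
  | zero => simp
  | add a b ha hb => simp [ha, hb]
  | single σ z =>
    simp [chainMap, boundary, Finsupp.linearCombination_single, Finsupp.mapDomain_single,
      ContinuousMap.comp_assoc, map_sum]

lemma chainMap_mem_chainsIn {A : Set Y} (φ : C(Y, Y)) (hφ : ∀ y ∈ A, φ y ∈ A) {k : ℕ}
    {c : SingularChain Y k} (hc : c ∈ chainsIn A k) : chainMap φ k c ∈ chainsIn A k := by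
  classical
  intro σ hσ
  obtain ⟨τ, hτ, rfl⟩ := Finset.mem_image.1 (Finsupp.mapDomain_support hσ)
  exact fun p => hφ _ (hc hτ p)

lemma chainMap_mem_relCycles {A : Set Y} (φ : C(Y, Y)) (hφ : ∀ y ∈ A, φ y ∈ A) {k : ℕ}
    {c : SingularChain Y k} (hc : c ∈ relCycles A k) : chainMap φ k c ∈ relCycles A k := by
  cases k with
  | zero => trivial
  | succ k =>
    change boundary Y k (chainMap φ (k + 1) c) ∈ chainsIn A k
    rw [← chainMap_boundary]
    exact chainMap_mem_chainsIn φ hφ hc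

lemma chainMap_mem_relBoundaries {A : Set Y} (φ : C(Y, Y)) (hφ : ∀ y ∈ A, φ y ∈ A) {k : ℕ}
    {c : SingularChain Y k} (hc : c ∈ relBoundaries A k) :
    chainMap φ k c ∈ relBoundaries A k := by
  obtain ⟨_, ⟨b, rfl⟩, a, ha, rfl⟩ := Submodule.mem_sup.1 hc
  rw [map_add, chainMap_boundary]
  exact Submodule.add_mem_sup ⟨_, rfl⟩ (chainMap_mem_chainsIn φ hφ ha)

/-- The endomorphism of `H_k(Y, A; ℤ)` induced by a continuous self-map of the pair `(Y, A)`. -/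
def relHomologyMap (A : Set Y) (φ : C(Y, Y)) (hφ : ∀ y ∈ A, φ y ∈ A) (k : ℕ) :
    RelHomology A k →ₗ[ℤ] RelHomology A k :=
  Submodule.mapQ _ _
    ((chainMap φ k).restrict (p := relCycles A k) (q := relCycles A k)
      fun _ hc => chainMap_mem_relCycles φ hφ hc)
    fun _ hc => chainMap_mem_relBoundaries φ hφ hc

end Singular

/-! ### Equivariant simplicial cohomology -/

section Cohomology

variable {G : Type w} [Group G] {X : SSet.{u}} (a : G →* End X)
  {A : Type v} [AddCommGroup A] (α : Representation ℤ G A)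

/-- The group of `G`-equivariant `k`-cochains of a simplicial set `X` with coefficients in a
`G`-module `A`, that is `Hom_{ℤ[G]}(C_k(X), A)`. -/
def equivCochains (k : ℕ) : Submodule ℤ (X.obj (op (SimplexCategory.mk k)) → A) where
  carrier := {c | ∀ (g : G) (x : X.obj (op (SimplexCategory.mk k))), c ((a g).app (op (SimplexCategory.mk k)) x) = α g (c x)}
  zero_mem' := by simp
  add_mem' hc hd g x := by simp [hc g x, hd g x]
  smul_mem' z c hc g x := by simp [hc g x]

/-- The coboundary operator `(δ c)(x) = ∑ (-1)^i c(d_i x)` on equivariant cochains. -/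
def coboundary (k : ℕ) : equivCochains a α k →ₗ[ℤ] equivCochains a α (k + 1) where
  toFun c := ⟨fun x => ∑ i : Fin (k + 2), ((-1 : ℤ) ^ (i : ℕ)) • c.1 (X.δ i x), by
    intro g x
    rw [map_sum]
    refine Finset.sum_congr rfl fun i _ => ?_
    rw [map_zsmul, ← c.2 g]
    exact congrArg (fun y => ((-1 : ℤ) ^ (i : ℕ)) • c.1 y)
      (NatTrans.naturality_apply (a g) (SimplexCategory.δ i).op x).symm⟩
  map_add' c d := by
    ext x
    simp [Finset.sum_add_distrib]
  map_smul' z c := by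
    ext x
    simp only [Submodule.coe_smul, Pi.smul_apply, RingHom.id_apply, Finset.smul_sum]
    exact Finset.sum_congr rfl fun i _ => smul_comm _ _ _

/-- Equivariant cocycles. -/
def equivCocycles (k : ℕ) : Submodule ℤ (equivCochains a α k) :=
  LinearMap.ker (coboundary a α k)

/-- Equivariant coboundaries; there are none but `0` in degree `0`. -/
def equivCoboundaries : (k : ℕ) → Submodule ℤ (equivCochains a α k)
  | 0 => ⊥
  | k + 1 => LinearMap.range (coboundary a α k)

/-- The equivariant cohomology group `H_G^k(X; A)` of a simplicial set with a free `G`-action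
(for a free action this is the cohomology of `X / G` with coefficients twisted by `A`). -/
abbrev EquivCohomology (k : ℕ) : Type (max u v) :=
  equivCocycles a α k ⧸ (equivCoboundaries a α k).submoduleOf (equivCocycles a α k)

end Cohomology

/-! ### The equivariant Euler class of a real representation -/

section Euler

variable {G : Type w} [Group G]
  {V : Type v} [AddCommGroup V] [Module ℝ V] [TopologicalSpace V] [IsTopologicalAddGroup V]
  [ContinuousSMul ℝ V] [T2Space V] [FiniteDimensional ℝ V] (ρ : Representation ℝ G V)

/-- The action of `g` on `V`, as a continuous map. -/
def actionMap (g : G) : C(V, V) := ⟨ρ g, (ρ g).continuous_of_finiteDimensional⟩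

lemma actionMap_ne_zero (g : G) : ∀ y ∈ ({0}ᶜ : Set V), actionMap ρ g y ∈ ({0}ᶜ : Set V) := by
  intro y hy h
  apply hy
  have h1 : ρ g y = 0 := h
  have h2 : ρ g⁻¹ (ρ g y) = y := by
    rw [← Module.End.mul_apply, ← map_mul, inv_mul_cancel, map_one, Module.End.one_apply]
  rw [h1, map_zero] at h2
  exact h2.symm

/-- The group `H_n(V, V ∖ {0}; ℤ)` as a `G`-module. When `n = dim V` it is infinite cyclic, its
two generators are the orientations of `V`, and `g` acts by the sign of `det (ρ g)`. -/
def orientationModule (n : ℕ) : Representation ℤ G (RelHomology ({0}ᶜ : Set V) n) where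
  toFun g := relHomologyMap _ (actionMap ρ g) (actionMap_ne_zero ρ g) n
  map_one' := by
    refine LinearMap.ext fun z => ?_
    obtain ⟨⟨c, hc⟩, rfl⟩ := Submodule.mkQ_surjective _ z
    refine congrArg (Submodule.Quotient.mk) (Subtype.ext ?_)
    change Finsupp.mapDomain _ c = c
    have : (fun σ : SingularSimplex V n => (actionMap ρ 1).comp σ) = id := by
      funext σ
      ext p
      simp [actionMap]
    rw [this, Finsupp.mapDomain_id]
  map_mul' g h := by
    refine LinearMap.ext fun z => ?_
    obtain ⟨⟨c, hc⟩, rfl⟩ := Submodule.mkQ_surjective _ z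
    refine congrArg (Submodule.Quotient.mk) (Subtype.ext ?_)
    change Finsupp.mapDomain _ c = Finsupp.mapDomain _ (Finsupp.mapDomain _ c)
    rw [← Finsupp.mapDomain_comp]
    congr 1
    funext σ
    ext p
    simp [actionMap]

variable {X : SSet.{u}} (a : G →* End X)

/-- A continuous `G`-equivariant map `|X| → V`, given by its restrictions to the simplices of `X`,
that has no zero on the `(n-1)`-skeleton of `X`. -/
structure SkeletalSection (n : ℕ) where
  /-- the restriction of the map to a simplex -/
  toFun : ∀ k : ℕ, X.obj (op (SimplexCategory.mk k)) → SingularSimplex V k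
  compat : ∀ {m k : ℕ} (θ : SimplexCategory.mk m ⟶ SimplexCategory.mk k) (x : X.obj (op (SimplexCategory.mk k))),
    toFun m (X.map θ.op x) = (toFun k x).comp (simplexMap θ.toOrderHom)
  equivariant : ∀ (g : G) (k : ℕ) (x : X.obj (op (SimplexCategory.mk k))),
    toFun k ((a g).app (op (SimplexCategory.mk k)) x) = (actionMap ρ g).comp (toFun k x)
  ne_zero : ∀ k < n, ∀ (x : X.obj (op (SimplexCategory.mk k))) (p), toFun k x p ≠ 0

namespace SkeletalSection

variable {ρ a} {n : ℕ} (f : SkeletalSection ρ a n)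

lemma boundary_single (k : ℕ) (x : X.obj (op (SimplexCategory.mk (k + 1)))) :
    boundary V k (Finsupp.single (f.toFun (k + 1) x) 1) =
      ∑ i : Fin (k + 2), ((-1 : ℤ) ^ (i : ℕ)) • Finsupp.single (f.toFun k (X.δ i x)) (1 : ℤ) := by
  rw [boundary, Finsupp.linearCombination_single, one_smul]
  refine Finset.sum_congr rfl fun i _ => ?_
  congr 2
  exact (f.compat (SimplexCategory.δ i) x).symm

lemma single_mem_relCycles (x : X.obj (op (SimplexCategory.mk n))) :
    Finsupp.single (f.toFun n x) (1 : ℤ) ∈ relCycles ({0}ᶜ : Set V) n := by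
  cases n with
  | zero => trivial
  | succ k =>
    change boundary V k _ ∈ chainsIn _ k
    rw [boundary_single]
    refine Submodule.sum_mem _ fun i _ => Submodule.smul_mem _ _ ?_
    exact Finsupp.single_mem_supported ℤ _ fun p => f.ne_zero k (Nat.lt_succ_self k) _ p

/-- The cochain assigning to an `n`-simplex `x` the class in `H_n(V, V ∖ {0}; ℤ)` of the
restriction of the section to `x`: the pullback of the Thom class of `V`. -/
def eulerCochain : equivCochains a (orientationModule ρ n) n :=
  ⟨fun x => Submodule.Quotient.mk ⟨Finsupp.single (f.toFun n x) 1, f.single_mem_relCycles x⟩, by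
    intro g x
    refine congrArg Submodule.Quotient.mk (Subtype.ext ?_)
    change Finsupp.single _ _ = Finsupp.mapDomain _ (Finsupp.single _ _)
    rw [Finsupp.mapDomain_single, f.equivariant]⟩

/-- The cochain of a section is a cocycle. -/
def eulerCocycle : equivCocycles a (orientationModule ρ n) n :=
  ⟨f.eulerCochain, by
    refine LinearMap.mem_ker.2 (Subtype.ext (funext fun x => ?_))
    change ∑ i : Fin (n + 2), ((-1 : ℤ) ^ (i : ℕ)) •
      (Submodule.mkQ _ ⟨Finsupp.single (f.toFun n (X.δ i x)) 1, f.single_mem_relCycles _⟩ :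
        RelHomology ({0}ᶜ : Set V) n) = 0
    simp only [← map_zsmul, ← map_sum]
    refine (Submodule.Quotient.mk_eq_zero _).2 ?_
    change ((∑ i : Fin (n + 2), ((-1 : ℤ) ^ (i : ℕ)) •
      (⟨Finsupp.single (f.toFun n (X.δ i x)) 1, f.single_mem_relCycles _⟩ :
        relCycles ({0}ᶜ : Set V) n) : relCycles ({0}ᶜ : Set V) n) : SingularChain V n) ∈
      relBoundaries ({0}ᶜ : Set V) n
    rw [AddSubmonoidClass.coe_finsetSum]
    simp only [Submodule.coe_smul]
    rw [← boundary_single]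
    exact Submodule.mem_sup_left ⟨_, rfl⟩⟩

end SkeletalSection

/-- `e` is the equivariant Euler class `e(V) ∈ H_G^n(X; ±ℤ)` of the `n`-dimensional representation
`V` over the free `G`-space `X`, i.e. the Euler class of the vector bundle `(X × V) / G → X / G`:
the primary obstruction to a nowhere vanishing equivariant map `X → V`. It is the class of
the cocycle of any section without zeros on the `(n-1)`-skeleton. -/
def IsEulerClass (n : ℕ) (e : EquivCohomology a (orientationModule ρ n) n) : Prop :=
  ∃ f : SkeletalSection ρ a n, e = Submodule.Quotient.mk f.eulerCocycle

/-- The equivariant Euler class `e(V)` is non-zero on `X`. (For a free action a section as above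
exists and any two give the same class, so that `e(V)` is well defined.) -/
def EulerClassNonzero (n : ℕ) : Prop :=
  ∃ e : EquivCohomology a (orientationModule ρ n) n, IsEulerClass ρ a n e ∧ e ≠ 0

end Euler

/-! ### Simplicial complexes -/

section Complex

variable {ι : Type u} [DecidableEq ι] (K : AbstractSimplicialComplex ι)

/-- The simplicial set of ordered simplices of `K`: its `k`-simplices are the `(k+1)`-tuples of
vertices, possibly with repetitions, whose underlying set is a face of `K`. Its chain
complex is the ordered chain complex of `K`, and its realization is naturally homotopy
equivalent to that of `K`. -/
def orderedSSet : SSet.{u} where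
  obj m := {t : Fin (m.unop.len + 1) → ι // Finset.univ.image t ∈ K}
  map θ := TypeCat.ofHom fun t => ⟨t.1 ∘ θ.unop.toOrderHom,
    (K.isRelLowerSet_faces t.2).2
      (by
        intro v hv
        obtain ⟨i, -, rfl⟩ := Finset.mem_image.1 hv
        exact Finset.mem_image_of_mem _ (Finset.mem_univ _))
      (Finset.univ_nonempty.image _)⟩

variable {G : Type w} [Group G] [MulAction G ι] (hK : ∀ (g : G), ∀ s ∈ K, g • s ∈ K)

/-- The action on ordered simplices induced by a simplicial action on `K`. -/
def orderedAction : G →* End (orderedSSet K) where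
  toFun g :=
    { app := fun m => TypeCat.ofHom fun t => ⟨fun i => g • t.1 i, by
        have h := hK g _ t.2
        rwa [Finset.smul_finset_def, Finset.image_image] at h⟩ }
  map_one' := by
    refine NatTrans.ext (funext fun m => ConcreteCategory.hom_ext _ _ fun t => ?_)
    exact Subtype.ext (funext fun i => one_smul G _)
  map_mul' g h := by
    refine NatTrans.ext (funext fun m => ConcreteCategory.hom_ext _ _ fun t => ?_)
    exact Subtype.ext (funext fun i => mul_smul g h _)

end Complex

end EquivariantEuler

end

/-! The argument is by contraposition: with fewer than `2 ^ n` orbits of non-degenerate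
`n`-simplices, some equivariant map has no zeros on any `n`-simplex, so its obstruction cocycle is
zero, and every other section has a cohomologous cocycle.

Attach to each orbit of vertices a generic vector and spread it equivariantly over the orbit, which
is possible because the action on vertices is free. For every choice of signs on vertex orbits, the
vectors `± b v` extend affinely to an equivariant map. The `n + 1` vertices of an `n`-simplex lie in
distinct orbits, so their signs are independent. The corresponding vectors satisfy a single linear
relation up to scale, with no zero coefficient, so `0` lies in the convex hull only for the signs of
that relation or their opposites (`signs_eq_of_zero_mem_hull`). Each orbit of `n`-simplices thus
excludes at most the fraction `2 ^ (-n)` of all sign choices, and fewer than `2 ^ n` orbits cannot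
exclude them all (`exists_signs`).

It remains to compare an arbitrary section `f` with this affine map `F`. The prism of the
straight-line homotopy gives a difference cochain as soon as the line has no zeros on the faces of
dimension at most `n - 2` (`exists_difference_cochain`). To arrange this, `f` is first replaced by a
Bernstein polynomial `B` of large degree on each simplex. These approximations are compatible with
faces and equivariant, and the line from `f` to `B` has no zeros on the relevant `(n-1)`-simplices.
The condition for the line from `B` to `F` is now polynomial: zeros on a face of dimension at most
`n - 2` form a family with fewer than `n` parameters after scaling, and a generic choice of vectors
avoids them by a count of Hausdorff dimension (`exists_generic_weights`). Signs are chosen last, so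
genericity is required for all sign patterns at once.

For a simplicial complex the ordered simplices are too numerous. A linear order on the vertex orbits
singles out the monotone tuples, which have exactly one non-degenerate simplex for each face. An
equivariant sorting operator, chain homotopic to the identity, shows that a cocycle which is a
coboundary on monotone tuples is one on all ordered tuples
(`mem_equivCoboundaries_of_restrictMonotone`). -/

noncomputable section

namespace EquivariantEuler

/-! ### Ordered chains -/

section OrderedChains

/-- Ordered `k`-chains on a vertex set `E`: formal combinations of `(k+1)`-tuples of vertices. -/
abbrev OrdChain (E : Type*) (k : ℕ) := (Fin (k + 1) → E) →₀ ℤ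

variable {E : Type*} {E' : Type*}

/-- The boundary operator on ordered chains. -/
def ordBoundary (E : Type*) (k : ℕ) : OrdChain E (k + 1) →ₗ[ℤ] OrdChain E k :=
  Finsupp.linearCombination ℤ fun t : Fin (k + 2) → E =>
    ∑ i : Fin (k + 2), ((-1 : ℤ) ^ (i : ℕ)) • Finsupp.single (t ∘ i.succAbove) (1 : ℤ)

/-- The cone operator, which prepends the vertex `b`. -/
def ordCone (b : E) (k : ℕ) : OrdChain E k →ₗ[ℤ] OrdChain E (k + 1) :=
  Finsupp.lmapDomain ℤ ℤ fun t : Fin (k + 1) → E => (Fin.cons b t : Fin (k + 2) → E)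

/-- The augmentation of ordered chains. -/
def ordAug (E : Type*) : OrdChain E 0 →ₗ[ℤ] ℤ :=
  Finsupp.linearCombination ℤ fun _ => (1 : ℤ)

/-- The map on ordered chains induced by a map of vertices. -/
def ordMap (φ : E → E') (k : ℕ) : OrdChain E k →ₗ[ℤ] OrdChain E' k :=
  Finsupp.lmapDomain ℤ ℤ fun t : Fin (k + 1) → E => φ ∘ t

lemma ordBoundary_single (k : ℕ) (t : Fin (k + 2) → E) :
    ordBoundary E k (Finsupp.single t 1) =
      ∑ i : Fin (k + 2), ((-1 : ℤ) ^ (i : ℕ)) • Finsupp.single (t ∘ i.succAbove) (1 : ℤ) := by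
  rw [ordBoundary, Finsupp.linearCombination_single, one_smul]

@[simp]
lemma ordCone_single (b : E) (k : ℕ) (t : Fin (k + 1) → E) (z : ℤ) :
    ordCone b k (Finsupp.single t z) = Finsupp.single (Fin.cons b t : Fin (k + 2) → E) z :=
  Finsupp.mapDomain_single

@[simp]
lemma ordAug_single (t : Fin 1 → E) (z : ℤ) : ordAug E (Finsupp.single t z) = z := by
  simp [ordAug]

@[simp]
lemma ordMap_single (φ : E → E') (k : ℕ) (t : Fin (k + 1) → E) (z : ℤ) :
    ordMap φ k (Finsupp.single t z) = Finsupp.single (φ ∘ t) z :=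
  Finsupp.mapDomain_single

/-- Two linear maps on a free `ℤ`-module that agree on generators agree. -/
lemma linearMap_eq_of_single {S M : Type*} [AddCommGroup M] {f g : (S →₀ ℤ) →ₗ[ℤ] M}
    (h : ∀ s, f (Finsupp.single s 1) = g (Finsupp.single s 1)) (c : S →₀ ℤ) : f c = g c := by
  have : f = g := Finsupp.lhom_ext' fun s => LinearMap.ext_ring (h s)
  rw [this]

lemma cons_comp_succ_succAbove {k : ℕ} (b : E) (t : Fin (k + 2) → E) (i : Fin (k + 2)) :
    (Fin.cons b t : Fin (k + 3) → E) ∘ i.succ.succAbove =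
      (Fin.cons b (t ∘ i.succAbove) : Fin (k + 2) → E) := by
  funext j
  refine Fin.cases ?_ (fun j => ?_) j
  · simp
  · simp

/-- Dropping the apex of a cone returns its base; dropping any other vertex gives the cone over a
face of the base, with the sign shifted by one. -/
lemma ordBoundary_ordCone_succ (b : E) (k : ℕ) (c : OrdChain E (k + 1)) :
    ordBoundary E (k + 1) (ordCone b (k + 1) c) = c - ordCone b k (ordBoundary E k c) := by
  refine linearMap_eq_of_single (f := ordBoundary E (k + 1) ∘ₗ ordCone b (k + 1))
    (g := LinearMap.id - ordCone b k ∘ₗ ordBoundary E k) (fun t => ?_) c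
  simp only [LinearMap.comp_apply, LinearMap.sub_apply, LinearMap.id_apply, ordCone_single,
    ordBoundary_single, map_sum, map_zsmul]
  rw [Fin.sum_univ_succ, sub_eq_add_neg, ← Finset.sum_neg_distrib]
  congr 1
  · rw [Fin.val_zero, pow_zero, one_smul]
    congr 1
  · refine Finset.sum_congr rfl fun i _ => ?_
    rw [cons_comp_succ_succAbove, Fin.val_succ, pow_succ, mul_neg_one, neg_smul]

lemma ordBoundary_ordCone_zero (b : E) (c : OrdChain E 0) :
    ordBoundary E 0 (ordCone b 0 c) = c - ordAug E c • Finsupp.single (fun _ => b) (1 : ℤ) := by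
  refine linearMap_eq_of_single (f := ordBoundary E 0 ∘ₗ ordCone b 0)
    (g := LinearMap.id - (ordAug E).smulRight (Finsupp.single (fun _ => b) (1 : ℤ)))
    (fun t => ?_) c
  simp only [LinearMap.comp_apply, LinearMap.sub_apply, LinearMap.id_apply, ordCone_single,
    ordBoundary_single, LinearMap.smulRight_apply, ordAug_single]
  have h0 : (Fin.cons b t : Fin 2 → E) ∘ (0 : Fin 2).succAbove = t := by
    funext j; simp
  have h1 : (Fin.cons b t : Fin 2 → E) ∘ (1 : Fin 2).succAbove = fun _ => b := by
    funext j
    rw [Subsingleton.elim j 0]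
    simp
  refine (Fin.sum_univ_two _).trans ?_
  rw [h0, h1]
  simp [sub_eq_add_neg]

lemma ordAug_ordBoundary (c : OrdChain E 1) : ordAug E (ordBoundary E 0 c) = 0 := by
  refine linearMap_eq_of_single (f := ordAug E ∘ₗ ordBoundary E 0) (g := 0) (fun t => ?_) c
  simp [ordBoundary_single, Fin.sum_univ_two]

/-- A tuple is the cone over its tail with apex its first entry, so the cone formula reduces the
identity to one degree lower and no double sum has to be rearranged. -/
lemma ordBoundary_ordBoundary (k : ℕ) (c : OrdChain E (k + 2)) :
    ordBoundary E k (ordBoundary E (k + 1) c) = 0 := by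
  induction k with
  | zero =>
    refine linearMap_eq_of_single (f := ordBoundary E 0 ∘ₗ ordBoundary E 1) (g := 0)
      (fun t => ?_) c
    have : Finsupp.single t (1 : ℤ) = ordCone (t 0) 1 (Finsupp.single (Fin.tail t) 1) := by
      rw [ordCone_single]
      exact congrArg (fun s => Finsupp.single s (1 : ℤ)) (Fin.cons_self_tail t).symm
    rw [this, LinearMap.comp_apply, ordBoundary_ordCone_succ, map_sub, ordBoundary_ordCone_zero,
      ordAug_ordBoundary]
    simp
  | succ k ih =>
    refine linearMap_eq_of_single (f := ordBoundary E (k + 1) ∘ₗ ordBoundary E (k + 2)) (g := 0)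
      (fun t => ?_) c
    have : Finsupp.single t (1 : ℤ) = ordCone (t 0) (k + 2) (Finsupp.single (Fin.tail t) 1) := by
      rw [ordCone_single]
      exact congrArg (fun s => Finsupp.single s (1 : ℤ)) (Fin.cons_self_tail t).symm
    rw [this, LinearMap.comp_apply, ordBoundary_ordCone_succ, map_sub, ordBoundary_ordCone_succ,
      ih]
    simp

lemma ordMap_ordBoundary (φ : E → E') (k : ℕ) (c : OrdChain E (k + 1)) :
    ordMap φ k (ordBoundary E k c) = ordBoundary E' k (ordMap φ (k + 1) c) := by
  refine linearMap_eq_of_single (f := ordMap φ k ∘ₗ ordBoundary E k)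
    (g := ordBoundary E' k ∘ₗ ordMap φ (k + 1)) (fun t => ?_) c
  simp [ordBoundary_single, Function.comp_assoc]

lemma ordMap_ordCone (φ : E → E') (b : E) (k : ℕ) (c : OrdChain E k) :
    ordMap φ (k + 1) (ordCone b k c) = ordCone (φ b) k (ordMap φ k c) := by
  refine linearMap_eq_of_single (f := ordMap φ (k + 1) ∘ₗ ordCone b k)
    (g := ordCone (φ b) k ∘ₗ ordMap φ k) (fun t => ?_) c
  simp only [LinearMap.comp_apply, ordCone_single, ordMap_single]
  congr 1
  exact (Fin.comp_cons φ b t)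

lemma ordAug_ordMap (φ : E → E') (c : OrdChain E 0) : ordAug E' (ordMap φ 0 c) = ordAug E c :=
  linearMap_eq_of_single (f := ordAug E' ∘ₗ ordMap φ 0) (g := ordAug E) (fun t => by simp) c

/-- Contraction of a chain map `F` (vanishing under augmentation) by coning off tuples `t` from
the vertex `b t`. -/
def ordFill (F : ∀ k, OrdChain E k →ₗ[ℤ] OrdChain E' k) (b : ∀ k, (Fin (k + 1) → E) → E') :
    ∀ k, OrdChain E k →ₗ[ℤ] OrdChain E' (k + 1)
  | 0 => Finsupp.linearCombination ℤ fun t => ordCone (b 0 t) 0 (F 0 (Finsupp.single t 1))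
  | k + 1 => Finsupp.linearCombination ℤ fun t => ordCone (b (k + 1) t) (k + 1)
      (F (k + 1) (Finsupp.single t 1) - ordFill F b k (ordBoundary E k (Finsupp.single t 1)))

/-! ### Explicit null-homotopies by iterated coning -/

section Fill

variable {F : ∀ k, OrdChain E k →ₗ[ℤ] OrdChain E' k} {b : ∀ k, (Fin (k + 1) → E) → E'}

lemma ordFill_zero_single (t : Fin 1 → E) :
    ordFill F b 0 (Finsupp.single t 1) = ordCone (b 0 t) 0 (F 0 (Finsupp.single t 1)) := by
  simp [ordFill]

lemma ordFill_succ_single (k : ℕ) (t : Fin (k + 2) → E) :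
    ordFill F b (k + 1) (Finsupp.single t 1) = ordCone (b (k + 1) t) (k + 1)
      (F (k + 1) (Finsupp.single t 1) -
        ordFill F b k (ordBoundary E k (Finsupp.single t 1))) := by
  rw [ordFill, Finsupp.linearCombination_single, one_smul]

lemma ordBoundary_ordFill_zero (h0 : ∀ c, ordAug E' (F 0 c) = 0) (c : OrdChain E 0) :
    ordBoundary E' 0 (ordFill F b 0 c) = F 0 c := by
  refine linearMap_eq_of_single (f := ordBoundary E' 0 ∘ₗ ordFill F b 0) (fun t => ?_) c
  rw [LinearMap.comp_apply, ordFill_zero_single, ordBoundary_ordCone_zero, h0, zero_smul, sub_zero]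

/-- The chain to be coned off, `F t` minus the filling of `∂ t`, is a cycle by the formula one
degree lower, and the boundary of the cone over a cycle of positive degree is that cycle, whatever
the apex. Hence the apex may depend freely on `t`. -/
lemma ordBoundary_ordFill_succ (h0 : ∀ c, ordAug E' (F 0 c) = 0)
    (hF : ∀ k c, ordBoundary E' k (F (k + 1) c) = F k (ordBoundary E k c))
    (k : ℕ) (c : OrdChain E (k + 1)) :
    ordBoundary E' (k + 1) (ordFill F b (k + 1) c) =
      F (k + 1) c - ordFill F b k (ordBoundary E k c) := by
  refine linearMap_eq_of_single (f := ordBoundary E' (k + 1) ∘ₗ ordFill F b (k + 1))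
    (g := F (k + 1) - ordFill F b k ∘ₗ ordBoundary E k) (fun t => ?_) c
  rw [LinearMap.comp_apply, ordFill_succ_single, ordBoundary_ordCone_succ, LinearMap.sub_apply,
    LinearMap.comp_apply, sub_eq_self, map_sub, hF]
  suffices h : ordBoundary E' k (ordFill F b k (ordBoundary E k (Finsupp.single t 1))) =
      F k (ordBoundary E k (Finsupp.single t 1)) by
    rw [h, sub_self, map_zero]
  cases k with
  | zero => exact ordBoundary_ordFill_zero h0 _
  | succ k =>
    rw [ordBoundary_ordFill_succ h0 hF k, ordBoundary_ordBoundary, map_zero, sub_zero]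

/-- The recursion involves nothing but `F`, the boundary and the apexes, so compatibility with `F`
and with the choice of apexes suffices. This yields both the restriction of prisms to faces and the
equivariance of the sorting homotopy. -/
lemma ordMap_ordFill {E₁ E₁' : Type*} {F₁ : ∀ k, OrdChain E₁ k →ₗ[ℤ] OrdChain E₁' k}
    {b₁ : ∀ k, (Fin (k + 1) → E₁) → E₁'} (φ : E → E₁) (ψ : E' → E₁')
    (hF : ∀ k c, ordMap ψ k (F k c) = F₁ k (ordMap φ k c))
    (hb : ∀ k t, ψ (b k t) = b₁ k (φ ∘ t)) (k : ℕ) (c : OrdChain E k) :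
    ordMap ψ (k + 1) (ordFill F b k c) = ordFill F₁ b₁ k (ordMap φ k c) := by
  induction k with
  | zero =>
    refine linearMap_eq_of_single (f := ordMap ψ 1 ∘ₗ ordFill F b 0)
      (g := ordFill F₁ b₁ 0 ∘ₗ ordMap φ 0) (fun t => ?_) c
    rw [LinearMap.comp_apply, LinearMap.comp_apply, ordMap_single, ordFill_zero_single,
      ordFill_zero_single, ordMap_ordCone, hF, hb, ordMap_single]
  | succ k ih =>
    refine linearMap_eq_of_single (f := ordMap ψ (k + 2) ∘ₗ ordFill F b (k + 1))
      (g := ordFill F₁ b₁ (k + 1) ∘ₗ ordMap φ (k + 1)) (fun t => ?_) c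
    rw [LinearMap.comp_apply, LinearMap.comp_apply, ordMap_single, ordFill_succ_single,
      ordFill_succ_single, ordMap_ordCone, map_sub, hF, hb, ih, ordMap_ordBoundary, ordMap_single]

/-- Chains supported on tuples with all vertices in `S`. -/
abbrev ordSupported (S : Set E) (k : ℕ) : Submodule ℤ (OrdChain E k) :=
  Finsupp.supported ℤ ℤ {t : Fin (k + 1) → E | ∀ i, t i ∈ S}

lemma ordSupported_mono {S T : Set E} (h : S ⊆ T) (k : ℕ) : ordSupported S k ≤ ordSupported T k :=
  Finsupp.supported_mono fun _ ht i => h (ht i)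

lemma ordCone_mem_supported {k : ℕ} {A : Set (Fin (k + 1) → E)} {B : Set (Fin (k + 2) → E)}
    {m : E} (h : ∀ t ∈ A, (Fin.cons m t : Fin (k + 2) → E) ∈ B) {c : OrdChain E k}
    (hc : c ∈ Finsupp.supported ℤ ℤ A) : ordCone m k c ∈ Finsupp.supported ℤ ℤ B := by
  classical
  intro s hs
  obtain ⟨t, ht, rfl⟩ := Finset.mem_image.1 (Finsupp.mapDomain_support hs)
  exact h t (hc ht)

lemma cons_mem {S : Set E} {k : ℕ} {m : E} (hm : m ∈ S) {t : Fin (k + 1) → E} (ht : ∀ i, t i ∈ S) :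
    ∀ i, (Fin.cons m t : Fin (k + 2) → E) i ∈ S := by
  intro i
  refine Fin.cases ?_ (fun j => ?_) i
  · simpa using hm
  · simpa using ht j

/-- A linear operator that sends each face of `t` to chains with vertices in that face sends
`∂ t` to chains with vertices in `t`. -/
lemma map_ordBoundary_mem {k l : ℕ} (Φ : OrdChain E k →ₗ[ℤ] OrdChain E l)
    (hΦ : ∀ t, Φ (Finsupp.single t 1) ∈ ordSupported (Set.range t) l) (t : Fin (k + 2) → E) :
    Φ (ordBoundary E k (Finsupp.single t 1)) ∈ ordSupported (Set.range t) l := by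
  rw [ordBoundary_single, map_sum]
  refine Submodule.sum_mem _ fun i _ => ?_
  rw [map_zsmul]
  exact Submodule.smul_mem _ _ (ordSupported_mono (Set.range_comp_subset_range _ _) _ (hΦ _))

lemma ordFill_mem {F : ∀ k, OrdChain E k →ₗ[ℤ] OrdChain E k} {b : ∀ k, (Fin (k + 1) → E) → E}
    (hF : ∀ k t, F k (Finsupp.single t 1) ∈ ordSupported (Set.range t) k)
    (hb : ∀ k t, b k t ∈ Set.range t) (k : ℕ) (t : Fin (k + 1) → E) :
    ordFill F b k (Finsupp.single t 1) ∈ ordSupported (Set.range t) (k + 1) := by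
  induction k with
  | zero =>
    rw [ordFill_zero_single]
    exact ordCone_mem_supported (A := {s | ∀ i, s i ∈ Set.range t})
      (B := {s | ∀ i, s i ∈ Set.range t})    (fun s hs => cons_mem (hb _ _) hs) (hF _ _)
  | succ k ih =>
    rw [ordFill_succ_single]
    exact ordCone_mem_supported (A := {s | ∀ i, s i ∈ Set.range t})
      (B := {s | ∀ i, s i ∈ Set.range t})    (fun s hs => cons_mem (hb _ _) hs)
      (Submodule.sub_mem _ (hF _ _) (map_ordBoundary_mem _ ih t))

end Fill

end OrderedChains

/-! ### The prism of a straight-line homotopy -/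

section Prism

/-! ### Singular chains from ordered chains on the vertices of a simplex -/

section Realization

variable {V : Type*} [TopologicalSpace V] {E : Type*} [Fintype E] {E' : Type*} [Fintype E']

/-- The affine map of topological simplices given by a map of vertices. -/
def vertexMap (φ : E → E') : C(stdSimplex ℝ E, stdSimplex ℝ E') :=
  ⟨stdSimplex.map φ, stdSimplex.continuous_map φ⟩

/-- The singular chain given by an ordered chain on the vertices of a simplex mapped to `V`. -/
def realize (H : C(stdSimplex ℝ E, V)) (k : ℕ) : OrdChain E k →ₗ[ℤ] SingularChain V k :=
  Finsupp.lmapDomain ℤ ℤ fun t : Fin (k + 1) → E => H.comp (vertexMap t)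

@[simp]
lemma realize_single (H : C(stdSimplex ℝ E, V)) (k : ℕ) (t : Fin (k + 1) → E) (z : ℤ) :
    realize H k (Finsupp.single t z) = Finsupp.single (H.comp (vertexMap t)) z :=
  Finsupp.mapDomain_single

lemma vertexMap_comp {E'' : Type*} [Fintype E''] (φ : E → E') (ψ : E' → E'') :
    (vertexMap ψ).comp (vertexMap φ) = vertexMap (ψ ∘ φ) :=
  ContinuousMap.ext fun p => stdSimplex.map_comp_apply φ ψ p

lemma boundary_singular_single (k : ℕ) (σ : SingularSimplex V (k + 1)) :
    boundary V k (Finsupp.single σ 1) =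
      ∑ i : Fin (k + 2), ((-1 : ℤ) ^ (i : ℕ)) •
        Finsupp.single (σ.comp (simplexMap i.succAbove)) (1 : ℤ) := by
  rw [boundary, Finsupp.linearCombination_single, one_smul]

lemma boundary_realize (H : C(stdSimplex ℝ E, V)) (k : ℕ) (c : OrdChain E (k + 1)) :
    boundary V k (realize H (k + 1) c) = realize H k (ordBoundary E k c) := by
  refine linearMap_eq_of_single (f := boundary V k ∘ₗ realize H (k + 1))
    (g := realize H k ∘ₗ ordBoundary E k) (fun t => ?_) c
  simp only [LinearMap.comp_apply, realize_single, boundary_singular_single, ordBoundary_single,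
    map_sum, map_zsmul]
  refine Finset.sum_congr rfl fun i _ => ?_
  rw [ContinuousMap.comp_assoc, ← vertexMap_comp]
  rfl

lemma realize_comp (H : C(stdSimplex ℝ E', V)) (φ : E → E') (k : ℕ) (c : OrdChain E k) :
    realize (H.comp (vertexMap φ)) k c = realize H k (ordMap φ k c) := by
  refine linearMap_eq_of_single (f := realize (H.comp (vertexMap φ)) k)
    (g := realize H k ∘ₗ ordMap φ k) (fun t => ?_) c
  simp only [LinearMap.comp_apply, realize_single, ordMap_single, ContinuousMap.comp_assoc,
    vertexMap_comp]

lemma realize_mem_chainsIn {A : Set V} {H : C(stdSimplex ℝ E, V)} (hH : ∀ z, H z ∈ A) (k : ℕ)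
    (c : OrdChain E k) : realize H k c ∈ chainsIn A k := by
  classical
  intro σ hσ
  obtain ⟨τ, -, rfl⟩ := Finset.mem_image.1 (Finsupp.mapDomain_support hσ)
  exact fun p => hH _

lemma chainMap_realize (φ : C(V, V)) (H : C(stdSimplex ℝ E, V)) (k : ℕ) (c : OrdChain E k) :
    chainMap φ k (realize H k c) = realize (φ.comp H) k c := by
  refine linearMap_eq_of_single (f := chainMap φ k ∘ₗ realize H k)
    (g := realize (φ.comp H) k) (fun t => ?_) c
  simp [chainMap, Finsupp.mapDomain_single, ContinuousMap.comp_assoc]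

end Realization

/-- The difference of the inclusions of the top and the bottom of a prism, on ordered chains. -/
def prismEnds (E : Type*) (k : ℕ) : OrdChain E k →ₗ[ℤ] OrdChain (E × Bool) k :=
  ordMap (fun v => (v, true)) k - ordMap (fun v => (v, false)) k

/-- The ordered chain triangulating the prism over the `k`-simplex. -/
def prismChain (k : ℕ) : OrdChain (Fin (k + 1) × Bool) (k + 1) :=
  ordFill (prismEnds (Fin (k + 1))) (fun _ t => (t 0, false)) k (Finsupp.single id 1)

lemma ordBoundary_prismChain_zero :
    ordBoundary _ 0 (prismChain 0) = prismEnds _ 0 (Finsupp.single id 1) :=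
  ordBoundary_ordFill_zero
    (fun c => by simp [prismEnds, ordAug_ordMap]) _

/-- The apex `(t 0, false)` commutes with face inclusions, so naturality of the filling identifies
the side walls with prisms over the faces. -/
lemma ordBoundary_prismChain_succ (k : ℕ) :
    ordBoundary _ (k + 1) (prismChain (k + 1)) = prismEnds _ (k + 1) (Finsupp.single id 1) -
      ∑ i : Fin (k + 2), ((-1 : ℤ) ^ (i : ℕ)) •
        ordMap (Prod.map i.succAbove id) (k + 1) (prismChain k) := by
  rw [prismChain, ordBoundary_ordFill_succ (fun c => by simp [prismEnds, ordAug_ordMap])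
    (fun k c => by simp [prismEnds, ordMap_ordBoundary]), ordBoundary_single, map_sum]
  congr 1
  refine Finset.sum_congr rfl fun i _ => ?_
  rw [map_zsmul, prismChain, ordMap_ordFill (F₁ := prismEnds (Fin (k + 2)))
    (b₁ := fun _ t => (t 0, false)) i.succAbove (Prod.map i.succAbove id), ordMap_single]
  · rfl
  · intro l c
    refine linearMap_eq_of_single (f := ordMap (Prod.map i.succAbove id) l ∘ₗ prismEnds _ l)
      (g := prismEnds _ l ∘ₗ ordMap i.succAbove l) (fun t => ?_) c
    simp only [prismEnds, LinearMap.comp_apply, LinearMap.sub_apply, ordMap_single, map_sub]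
    rfl
  · intro l t
    rfl

variable {V : Type*} [AddCommGroup V] [Module ℝ V] [TopologicalSpace V] [IsTopologicalAddGroup V]
  [ContinuousSMul ℝ V]

/-- The straight-line homotopy between two singular simplices, on the simplex spanned by the
vertices of the prism. -/
def lineHomotopy {k : ℕ} (σ₀ σ₁ : SingularSimplex V k) :
    C(stdSimplex ℝ (Fin (k + 1) × Bool), V) where
  toFun z := (vertexMap Prod.snd z) false • σ₀ (vertexMap Prod.fst z) +
    (vertexMap Prod.snd z) true • σ₁ (vertexMap Prod.fst z)
  continuous_toFun := by
    have h (b : Bool) : Continuous fun z : stdSimplex ℝ (Fin (k + 1) × Bool) =>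
        (vertexMap Prod.snd z) b :=
      (continuous_apply b).comp (continuous_subtype_val.comp (vertexMap Prod.snd).continuous)
    exact ((h false).smul (σ₀.continuous.comp (vertexMap Prod.fst).continuous)).add
      ((h true).smul (σ₁.continuous.comp (vertexMap Prod.fst).continuous))

lemma lineHomotopy_apply {k : ℕ} (σ₀ σ₁ : SingularSimplex V k)
    (z : stdSimplex ℝ (Fin (k + 1) × Bool)) :
    lineHomotopy σ₀ σ₁ z = (vertexMap Prod.snd z) false • σ₀ (vertexMap Prod.fst z) +
      (vertexMap Prod.snd z) true • σ₁ (vertexMap Prod.fst z) := rfl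

lemma lineHomotopy_comp {k l : ℕ} (σ₀ σ₁ : SingularSimplex V k) (φ : Fin (l + 1) → Fin (k + 1)) :
    lineHomotopy (σ₀.comp (simplexMap φ)) (σ₁.comp (simplexMap φ)) =
      (lineHomotopy σ₀ σ₁).comp (vertexMap (Prod.map φ id)) := by
  ext z
  have h1 : vertexMap Prod.fst (vertexMap (Prod.map φ (id : Bool → Bool)) z) =
      simplexMap φ (vertexMap Prod.fst z) := by
    change ((vertexMap _).comp (vertexMap _)) z = ((vertexMap _).comp (vertexMap _)) z
    rw [vertexMap_comp, vertexMap_comp]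
    rfl
  have h2 : vertexMap Prod.snd (vertexMap (Prod.map φ (id : Bool → Bool)) z) =
      vertexMap Prod.snd z := by
    change ((vertexMap _).comp (vertexMap _)) z = _
    rw [vertexMap_comp]
    rfl
  simp only [ContinuousMap.comp_apply, lineHomotopy_apply, h1, h2]

lemma vertexMap_const_apply {E E' : Type*} [Fintype E] [Fintype E'] [DecidableEq E'] (b e : E')
    (p : stdSimplex ℝ E) : (vertexMap (fun _ => b) p) e = if b = e then 1 else 0 := by
  classical
  change (stdSimplex.map (fun _ => b) p) e = _
  rw [stdSimplex.map_coe, FunOnFinite.linearMap_apply_apply]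
  split_ifs with h
  · simp [h]
  · simp [h]

lemma lineHomotopy_true {k : ℕ} (σ₀ σ₁ : SingularSimplex V k) :
    (lineHomotopy σ₀ σ₁).comp (vertexMap fun v => (v, true)) = σ₁ := by
  ext p
  have h1 : vertexMap Prod.fst (vertexMap (fun v : Fin (k + 1) => (v, true)) p) = p := by
    change ((vertexMap _).comp (vertexMap _)) p = _
    rw [vertexMap_comp]
    exact stdSimplex.map_id_apply p
  have h2 : vertexMap Prod.snd (vertexMap (fun v : Fin (k + 1) => (v, true)) p) =
      vertexMap (fun _ => true) p := by
    change ((vertexMap _).comp (vertexMap _)) p = _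
    rw [vertexMap_comp]
    rfl
  simp [lineHomotopy_apply, h1, h2, vertexMap_const_apply]

lemma lineHomotopy_false {k : ℕ} (σ₀ σ₁ : SingularSimplex V k) :
    (lineHomotopy σ₀ σ₁).comp (vertexMap fun v => (v, false)) = σ₀ := by
  ext p
  have h1 : vertexMap Prod.fst (vertexMap (fun v : Fin (k + 1) => (v, false)) p) = p := by
    change ((vertexMap _).comp (vertexMap _)) p = _
    rw [vertexMap_comp]
    exact stdSimplex.map_id_apply p
  have h2 : vertexMap Prod.snd (vertexMap (fun v : Fin (k + 1) => (v, false)) p) =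
      vertexMap (fun _ => false) p := by
    change ((vertexMap _).comp (vertexMap _)) p = _
    rw [vertexMap_comp]
    rfl
  simp [lineHomotopy_apply, h1, h2, vertexMap_const_apply]

/-- The two coordinates of the projection to the segment sum to `1`, so each value lies on the line
joining the values of `σ₀` and `σ₁` at one common point. -/
lemma lineHomotopy_ne_zero {k : ℕ} {σ₀ σ₁ : SingularSimplex V k}
    (h : ∀ p, ∀ t ∈ Set.Icc (0 : ℝ) 1, (1 - t) • σ₀ p + t • σ₁ p ≠ 0)
    (z : stdSimplex ℝ (Fin (k + 1) × Bool)) : lineHomotopy σ₀ σ₁ z ≠ 0 := by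
  have h1 := stdSimplex.sum_eq_one (vertexMap Prod.snd z)
  rw [Fintype.sum_bool] at h1
  rw [lineHomotopy_apply, eq_sub_of_add_eq' h1]
  exact h _ _ ⟨stdSimplex.zero_le _ _, stdSimplex.le_one _ _⟩

/-- The singular chain of the straight-line homotopy between two singular simplices. -/
def prism {k : ℕ} (σ₀ σ₁ : SingularSimplex V k) : SingularChain V (k + 1) :=
  realize (lineHomotopy σ₀ σ₁) (k + 1) (prismChain k)

lemma realize_prismEnds {k : ℕ} (σ₀ σ₁ : SingularSimplex V k) :
    realize (lineHomotopy σ₀ σ₁) k (prismEnds _ k (Finsupp.single id 1)) =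
      Finsupp.single σ₁ 1 - Finsupp.single σ₀ 1 := by
  rw [prismEnds, LinearMap.sub_apply, map_sub, ordMap_single, ordMap_single, realize_single,
    realize_single, Function.comp_id, Function.comp_id, lineHomotopy_true, lineHomotopy_false]

lemma boundary_prism_zero (σ₀ σ₁ : SingularSimplex V 0) :
    boundary V 0 (prism σ₀ σ₁) = Finsupp.single σ₁ 1 - Finsupp.single σ₀ 1 := by
  rw [prism, boundary_realize, ordBoundary_prismChain_zero, realize_prismEnds]

lemma boundary_prism_succ {k : ℕ} (σ₀ σ₁ : SingularSimplex V (k + 1)) :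
    boundary V (k + 1) (prism σ₀ σ₁) = Finsupp.single σ₁ 1 - Finsupp.single σ₀ 1 -
      ∑ i : Fin (k + 2), ((-1 : ℤ) ^ (i : ℕ)) •
        prism (σ₀.comp (simplexMap i.succAbove)) (σ₁.comp (simplexMap i.succAbove)) := by
  rw [prism, boundary_realize, ordBoundary_prismChain_succ, map_sub, realize_prismEnds, map_sum]
  congr 1
  refine Finset.sum_congr rfl fun i _ => ?_
  rw [map_zsmul, prism, lineHomotopy_comp, realize_comp]

/-- Linear maps preserve straight lines. This is what makes the difference cochain equivariant. -/
lemma chainMap_prism {k : ℕ} (φ : C(V, V)) (L : V →ₗ[ℝ] V) (hL : ∀ v, φ v = L v)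
    (σ₀ σ₁ : SingularSimplex V k) :
    chainMap φ (k + 1) (prism σ₀ σ₁) = prism (φ.comp σ₀) (φ.comp σ₁) := by
  have h : φ.comp (lineHomotopy σ₀ σ₁) = lineHomotopy (φ.comp σ₀) (φ.comp σ₁) := by
    ext z
    simp [lineHomotopy_apply, hL]
  rw [prism, chainMap_realize, prism, h]

end Prism

/-! ### Classes of relative cycles -/

section RelClass

variable {Y : Type*} [TopologicalSpace Y] {A : Set Y} {k : ℕ}

open Classical in
/-- The relative homology class of a chain, or `0` if the chain is not a relative cycle. -/
def relClass (A : Set Y) (k : ℕ) (z : SingularChain Y k) : RelHomology A k :=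
  if h : z ∈ relCycles A k then Submodule.Quotient.mk ⟨z, h⟩ else 0

lemma relClass_of_mem {z : SingularChain Y k} (h : z ∈ relCycles A k) :
    relClass A k z = Submodule.Quotient.mk ⟨z, h⟩ := dif_pos h

/-- The default value `0` off the relative cycles is not additive, hence the membership hypotheses
here and below. -/
lemma relClass_add {y z : SingularChain Y k} (hy : y ∈ relCycles A k) (hz : z ∈ relCycles A k) :
    relClass A k (y + z) = relClass A k y + relClass A k z := by
  rw [relClass_of_mem hy, relClass_of_mem hz, relClass_of_mem (add_mem hy hz)]
  rfl

lemma relClass_sub {y z : SingularChain Y k} (hy : y ∈ relCycles A k) (hz : z ∈ relCycles A k) :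
    relClass A k (y - z) = relClass A k y - relClass A k z := by
  rw [relClass_of_mem hy, relClass_of_mem hz, relClass_of_mem (sub_mem hy hz)]
  rfl

lemma relClass_smul (r : ℤ) {z : SingularChain Y k} (hz : z ∈ relCycles A k) :
    relClass A k (r • z) = r • relClass A k z := by
  rw [relClass_of_mem hz, relClass_of_mem (Submodule.smul_mem _ r hz)]
  rfl

lemma relClass_sum {ι : Type*} (s : Finset ι) (z : ι → SingularChain Y k)
    (hz : ∀ i ∈ s, z i ∈ relCycles A k) :
    relClass A k (∑ i ∈ s, z i) = ∑ i ∈ s, relClass A k (z i) := by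
  classical
  induction s using Finset.induction_on with
  | empty =>
    rw [Finset.sum_empty, Finset.sum_empty, relClass_of_mem (zero_mem _)]
    rfl
  | insert a s ha ih =>
    rw [Finset.sum_insert ha, Finset.sum_insert ha, relClass_add (hz a (Finset.mem_insert_self a s))
      (Submodule.sum_mem _ fun i hi => hz i (Finset.mem_insert_of_mem hi)),
      ih fun i hi => hz i (Finset.mem_insert_of_mem hi)]

/-- Both branches of the definition give `0`, so it need not be known that relative boundaries are
relative cycles. -/
lemma relClass_eq_zero {z : SingularChain Y k} (hz : z ∈ relBoundaries A k) :
    relClass A k z = 0 := by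
  rw [relClass]
  split_ifs
  · exact (Submodule.Quotient.mk_eq_zero _).2 hz
  · rfl

lemma relClass_eq_zero_of_chainsIn {z : SingularChain Y k} (hz : z ∈ chainsIn A k) :
    relClass A k z = 0 :=
  relClass_eq_zero (Submodule.mem_sup_right hz)

lemma relHomologyMap_relClass (φ : C(Y, Y)) (hφ : ∀ y ∈ A, φ y ∈ A) {z : SingularChain Y k}
    (hz : z ∈ relCycles A k) :
    relHomologyMap A φ hφ k (relClass A k z) = relClass A k (chainMap φ k z) := by
  rw [relClass_of_mem hz, relClass_of_mem (chainMap_mem_relCycles φ hφ hz)]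
  rfl

end RelClass

/-! ### The difference cochain of two equivariant maps -/

section Difference

variable {G : Type w} [Group G]
  {V : Type v} [AddCommGroup V] [Module ℝ V] [TopologicalSpace V] [IsTopologicalAddGroup V]
  [ContinuousSMul ℝ V] [T2Space V] [FiniteDimensional ℝ V] {ρ : Representation ℝ G V}
  {X : SSet.{u}} {a : G →* End X}

/-- An equivariant map without zeros on a skeleton, regarded as a mere equivariant map. -/
def SkeletalSection.forget {n : ℕ} (f : SkeletalSection ρ a n) : SkeletalSection ρ a 0 :=
  ⟨f.toFun, f.compat, f.equivariant, fun _ h => absurd h (Nat.not_lt_zero _)⟩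

lemma SkeletalSection.toFun_δ {n k : ℕ} (f : SkeletalSection ρ a n)
    (x : X.obj (op (SimplexCategory.mk (k + 1)))) (i : Fin (k + 2)) :
    f.toFun k (X.δ i x) = (f.toFun (k + 1) x).comp (simplexMap i.succAbove) :=
  f.compat (SimplexCategory.δ i) x

/-- The straight-line homotopy between `f₀` and `f₁` has no zero on the simplex `x`. -/
def LineNeZero {n₀ n₁ k : ℕ} (f₀ : SkeletalSection ρ a n₀) (f₁ : SkeletalSection ρ a n₁)
    (x : X.obj (op (SimplexCategory.mk k))) : Prop :=
  ∀ p, ∀ t ∈ Set.Icc (0 : ℝ) 1, (1 - t) • f₀.toFun k x p + t • f₁.toFun k x p ≠ 0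

lemma single_mem_relCycles_of_faces {m : ℕ} (f : SkeletalSection ρ a 0)
    (σ : X.obj (op (SimplexCategory.mk (m + 1))))
    (h : ∀ i, ∀ p, f.toFun m (X.δ i σ) p ≠ 0) :
    Finsupp.single (f.toFun (m + 1) σ) (1 : ℤ) ∈ relCycles ({0}ᶜ : Set V) (m + 1) := by
  change boundary V m _ ∈ chainsIn _ m
  rw [SkeletalSection.boundary_single]
  exact Submodule.sum_mem _ fun i _ => Submodule.smul_mem _ _
    (Finsupp.single_mem_supported ℤ _ (h i))

/-- The boundary of the prism consists of its top, its bottom and its side walls, and each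
hypothesis keeps one of these away from `0`. The equation `m = k + 1` expresses that there are no
side walls when `m = 0`. -/
lemma prism_mem_relCycles {m : ℕ} (f₀ f₁ : SkeletalSection ρ a 0)
    (τ : X.obj (op (SimplexCategory.mk m)))
    (h₀ : ∀ p, f₀.toFun m τ p ≠ 0) (h₁ : ∀ p, f₁.toFun m τ p ≠ 0)
    (hf : ∀ k, ∀ e : m = k + 1, ∀ i, LineNeZero f₀ f₁ (X.δ i (e ▸ τ))) :
    prism (f₀.toFun m τ) (f₁.toFun m τ) ∈ relCycles ({0}ᶜ : Set V) (m + 1) := by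
  change boundary V m _ ∈ chainsIn _ m
  have hmem : (Finsupp.single (f₁.toFun m τ) 1 - Finsupp.single (f₀.toFun m τ) 1 :
      SingularChain V m) ∈ chainsIn ({0}ᶜ : Set V) m :=
    sub_mem (Finsupp.single_mem_supported ℤ _ h₁) (Finsupp.single_mem_supported ℤ _ h₀)
  cases m with
  | zero => rwa [boundary_prism_zero]
  | succ k =>
    rw [boundary_prism_succ]
    refine sub_mem hmem (Submodule.sum_mem _ fun i _ => Submodule.smul_mem _ _ ?_)
    rw [← SkeletalSection.toFun_δ, ← SkeletalSection.toFun_δ]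
    exact realize_mem_chainsIn (lineHomotopy_ne_zero (hf k rfl i)) _ _

lemma orientationModule_relClass (g : G) {n : ℕ} {z : SingularChain V n}
    (hz : z ∈ relCycles ({0}ᶜ : Set V) n) :
    orientationModule ρ n g (relClass _ n z) = relClass _ n (chainMap (actionMap ρ g) n z) :=
  relHomologyMap_relClass _ (actionMap_ne_zero ρ g) hz

/-- Two equivariant maps without zeros on a `G`-stable set `S` of `m`-simplices, joined by a
straight line without zeros on the boundaries of the simplices in `S`, have cohomologous obstruction
cocycles on the `(m+1)`-simplices whose faces lie in `S`. -/
lemma exists_difference_cochain {m : ℕ} (f₀ f₁ : SkeletalSection ρ a 0)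
    (S : Set (X.obj (op (SimplexCategory.mk m))))
    (hS : ∀ g : G, ∀ x, (a g).app (op (SimplexCategory.mk m)) x ∈ S ↔ x ∈ S)
    (h₀ : ∀ x ∈ S, ∀ p, f₀.toFun m x p ≠ 0) (h₁ : ∀ x ∈ S, ∀ p, f₁.toFun m x p ≠ 0)
    (hf : ∀ x ∈ S, ∀ k, ∀ e : m = k + 1, ∀ i, LineNeZero f₀ f₁ (X.δ i (e ▸ x))) :
    ∃ c : equivCochains a (orientationModule ρ (m + 1)) m,
      (∀ x ∉ S, c.1 x = 0) ∧
      ∀ σ : X.obj (op (SimplexCategory.mk (m + 1))), (∀ i, X.δ i σ ∈ S) →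
        ((coboundary a (orientationModule ρ (m + 1)) m c).1 σ : RelHomology ({0}ᶜ : Set V) (m + 1))
          = relClass ({0}ᶜ : Set V) (m + 1) (Finsupp.single (f₁.toFun (m + 1) σ) 1) -
            relClass ({0}ᶜ : Set V) (m + 1) (Finsupp.single (f₀.toFun (m + 1) σ) 1) := by
  classical
  have hc : ∀ x ∈ S, prism (f₀.toFun m x) (f₁.toFun m x) ∈ relCycles ({0}ᶜ : Set V) (m + 1) :=
    fun x hx => prism_mem_relCycles f₀ f₁ x (h₀ x hx) (h₁ x hx) (hf x hx)
  -- The cochain is the class of the prism over the simplices in `S`, extended by zero; equivariance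
  -- of the extension rests on the stability of `S`.
  let c₀ : X.obj (op (SimplexCategory.mk m)) → RelHomology ({0}ᶜ : Set V) (m + 1) := fun x =>
    if x ∈ S then relClass _ (m + 1) (prism (f₀.toFun m x) (f₁.toFun m x)) else 0
  have hc₀ : c₀ ∈ equivCochains a (orientationModule ρ (m + 1)) m := by
    intro g x
    by_cases hx : x ∈ S
    · simp only [c₀, if_pos hx, if_pos ((hS g x).2 hx)]
      rw [orientationModule_relClass g (hc x hx), chainMap_prism _ (ρ g) (fun _ => rfl),
        f₀.equivariant, f₁.equivariant]
    · simp only [c₀, if_neg hx, if_neg (fun h => hx ((hS g x).1 h)), map_zero]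
  refine ⟨⟨c₀, hc₀⟩, fun x hx => if_neg hx, fun σ hσ => ?_⟩
  have e₀ := single_mem_relCycles_of_faces f₀ σ fun i => h₀ _ (hσ i)
  have e₁ := single_mem_relCycles_of_faces f₁ σ fun i => h₁ _ (hσ i)
  have hsum : ∑ i : Fin (m + 2), ((-1 : ℤ) ^ (i : ℕ)) •
      prism (f₀.toFun m (X.δ i σ)) (f₁.toFun m (X.δ i σ)) =
      (Finsupp.single (f₁.toFun (m + 1) σ) 1 - Finsupp.single (f₀.toFun (m + 1) σ) 1) -
        boundary V (m + 1) (prism (f₀.toFun (m + 1) σ) (f₁.toFun (m + 1) σ)) := by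
    rw [boundary_prism_succ, sub_sub_cancel]
    simp only [SkeletalSection.toFun_δ]
  have hs : ∀ i ∈ (Finset.univ : Finset (Fin (m + 2))), ((-1 : ℤ) ^ (i : ℕ)) •
      prism (f₀.toFun m (X.δ i σ)) (f₁.toFun m (X.δ i σ)) ∈ relCycles ({0}ᶜ : Set V) (m + 1) :=
    fun i _ => Submodule.smul_mem _ _ (hc _ (hσ i))
  -- A difference of relative cycles is a relative cycle, so this follows from `hsum` without
  -- computing a double boundary.
  have hb : boundary V (m + 1) (prism (f₀.toFun (m + 1) σ) (f₁.toFun (m + 1) σ)) ∈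
      relCycles ({0}ᶜ : Set V) (m + 1) := by
    have h := sub_mem (sub_mem e₁ e₀) (Submodule.sum_mem _ hs)
    rwa [hsum, sub_sub_cancel] at h
  calc ∑ i : Fin (m + 2), ((-1 : ℤ) ^ (i : ℕ)) • c₀ (X.δ i σ)
      = ∑ i : Fin (m + 2), relClass ({0}ᶜ : Set V) (m + 1) (((-1 : ℤ) ^ (i : ℕ)) •
          prism (f₀.toFun m (X.δ i σ)) (f₁.toFun m (X.δ i σ))) :=
        Finset.sum_congr rfl fun i _ => by
          rw [relClass_smul _ (hc _ (hσ i))]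
          simp only [c₀, if_pos (hσ i)]
    _ = _ := by
        rw [← relClass_sum _ _ hs, hsum, relClass_sub (sub_mem e₁ e₀) hb, relClass_sub e₁ e₀,
          relClass_eq_zero (Submodule.mem_sup_left ⟨_, rfl⟩), sub_zero]

end Difference

/-! ### Bernstein operators on simplices -/

section Bernstein

/-- The barycenter of the standard simplex with `N + 1` vertices. -/
def barycenterPoint (N : ℕ) : stdSimplex ℝ (Fin (N + 1)) :=
  ⟨fun _ => ((N : ℝ) + 1)⁻¹, fun _ => by positivity, by
    rw [Finset.sum_const, Finset.card_univ, Fintype.card_fin, nsmul_eq_mul, Nat.cast_add_one,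
      mul_inv_cancel₀ (by positivity)]⟩

variable {I I' : Type*} [Fintype I] [Fintype I']

section Definition

variable {V : Type*} [AddCommGroup V] [Module ℝ V]

/-- The homogeneous Bernstein polynomial of degree `N + 1` of a function on a simplex. -/
def bernsteinForm (N : ℕ) (F : stdSimplex ℝ I → V) (y : I → ℝ) : V :=
  ∑ j : Fin (N + 1) → I, (∏ i, y (j i)) • F (vertexMap j (barycenterPoint N))

lemma bernsteinForm_smul (N : ℕ) (F : stdSimplex ℝ I → V) (r : ℝ) (y : I → ℝ) :
    bernsteinForm N F (r • y) = r ^ (N + 1) • bernsteinForm N F y := by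
  rw [bernsteinForm, bernsteinForm, Finset.smul_sum]
  refine Finset.sum_congr rfl fun j _ => ?_
  simp [Finset.prod_mul_distrib, mul_smul]

lemma bernsteinForm_map_linear {W : Type*} [AddCommGroup W] [Module ℝ W] (N : ℕ) (L : V →ₗ[ℝ] W)
    (F : stdSimplex ℝ I → V) (y : I → ℝ) :
    L (bernsteinForm N F y) = bernsteinForm N (fun p => L (F p)) y := by
  simp [bernsteinForm]

/-- Each coordinate of the image point is a sum over a fibre of `θ`; expanding the product of these
sums gives the sum over tuples upstairs. It makes the approximations on different simplices agree on
common faces. -/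
lemma bernsteinForm_comp_map (N : ℕ) (θ : I → I') (F : stdSimplex ℝ I' → V)
    (p : stdSimplex ℝ I) :
    bernsteinForm N F (vertexMap θ p) = bernsteinForm N (fun q => F (vertexMap θ q)) p := by
  classical
  rw [bernsteinForm, bernsteinForm,
    ← Finset.sum_fiberwise Finset.univ (fun l : Fin (N + 1) → I => θ ∘ l)]
  refine Finset.sum_congr rfl fun j _ => ?_
  have h : ∀ i, (vertexMap θ p) (j i) = ∑ l ∈ Finset.univ.filter (fun l => θ l = j i), p l :=
    fun i => FunOnFinite.linearMap_apply_apply ℝ ℝ θ p (j i)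
  simp only [h]
  rw [Finset.prod_univ_sum, Finset.sum_smul]
  have hset : Fintype.piFinset (fun i => Finset.univ.filter fun l => θ l = j i) =
      Finset.univ.filter fun l : Fin (N + 1) → I => θ ∘ l = j := by
    ext l
    simp [funext_iff]
  rw [hset]
  refine Finset.sum_congr rfl fun l hl => ?_
  rw [← (Finset.mem_filter.1 hl).2, ← vertexMap_comp]
  rfl

end Definition

lemma sum_fin_succ_fun {M : Type*} [AddCommMonoid M] {N : ℕ} (f : (Fin (N + 1) → I) → M) :
    ∑ j, f j = ∑ l : I, ∑ j : Fin N → I, f (Fin.cons l j) := by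
  rw [← Fintype.sum_prod_type' (f := fun l (j : Fin N → I) => f (Fin.cons l j))]
  exact (Fintype.sum_equiv (Fin.consEquiv fun _ => I) _ _ fun _ => rfl).symm

lemma sum_prod_weights (p : stdSimplex ℝ I) (N : ℕ) : ∑ j : Fin N → I, ∏ i, p (j i) = 1 := by
  classical
  rw [← Fintype.sum_pow, stdSimplex.sum_eq_one, one_pow]

/-- The products of weights are the law of `N` independent samples from `p`, and a sum of centred
variables has mean zero. -/
lemma sum_weights_mul_sum (p : stdSimplex ℝ I) (b : I → ℝ) (hb : ∑ l, p l * b l = 0) (N : ℕ) :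
    ∑ j : Fin N → I, (∏ i, p (j i)) * ∑ i, b (j i) = 0 := by
  induction N with
  | zero => simp
  | succ N ih =>
    rw [sum_fin_succ_fun]
    simp only [Fin.prod_univ_succ, Fin.sum_univ_succ, Fin.cons_zero, Fin.cons_succ]
    have : ∀ l, ∑ j : Fin N → I, p l * (∏ i, p (j i)) * (b l + ∑ i, b (j i)) =
        p l * b l * ∑ j : Fin N → I, (∏ i, p (j i)) +
          p l * ∑ j : Fin N → I, (∏ i, p (j i)) * ∑ i, b (j i) := by
      intro l
      rw [Finset.mul_sum, Finset.mul_sum, ← Finset.sum_add_distrib]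
      exact Finset.sum_congr rfl fun j _ => by ring
    simp only [this, ih, sum_prod_weights, mul_one, mul_zero, add_zero, hb]

/-- The variance of a sum of independent centred variables. -/
lemma sum_weights_mul_sum_sq (p : stdSimplex ℝ I) (b : I → ℝ) (hb : ∑ l, p l * b l = 0) (N : ℕ) :
    ∑ j : Fin N → I, (∏ i, p (j i)) * (∑ i, b (j i)) ^ 2 = N * ∑ l, p l * b l ^ 2 := by
  induction N with
  | zero => simp
  | succ N ih =>
    rw [sum_fin_succ_fun]
    simp only [Fin.prod_univ_succ, Fin.sum_univ_succ, Fin.cons_zero, Fin.cons_succ]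
    have : ∀ l, ∑ j : Fin N → I, p l * (∏ i, p (j i)) * (b l + ∑ i, b (j i)) ^ 2 =
        p l * b l ^ 2 * ∑ j : Fin N → I, (∏ i, p (j i)) +
          2 * p l * b l * (∑ j : Fin N → I, (∏ i, p (j i)) * ∑ i, b (j i)) +
          p l * ∑ j : Fin N → I, (∏ i, p (j i)) * (∑ i, b (j i)) ^ 2 := by
      intro l
      rw [Finset.mul_sum, Finset.mul_sum, Finset.mul_sum, ← Finset.sum_add_distrib,
        ← Finset.sum_add_distrib]
      exact Finset.sum_congr rfl fun j _ => by ring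
    simp only [this, ih, sum_prod_weights, sum_weights_mul_sum p b hb, mul_one, mul_zero, add_zero,
      Finset.sum_add_distrib]
    rw [← Finset.sum_mul, stdSimplex.sum_eq_one]
    push_cast
    ring

/-- The `l`-th coordinate of the barycenter of the sampled vertices is the mean of `N + 1`
independent indicators, with variance `p l * (1 - p l) / (N + 1)`, at most `p l / (N + 1)`. These
bounds are summed over `l`. -/
lemma sum_weights_mul_mean_sub_sq_le (p : stdSimplex ℝ I) (N : ℕ) :
    ∑ j : Fin (N + 1) → I, (∏ i, p (j i)) *
      ∑ l, ((vertexMap j (barycenterPoint N)) l - p l) ^ 2 ≤ ((N : ℝ) + 1)⁻¹ := by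
  classical
  have hN : (N : ℝ) + 1 ≠ 0 := by positivity
  have hmean : ∀ (j : Fin (N + 1) → I) (l : I), (vertexMap j (barycenterPoint N)) l - p l =
      ((N : ℝ) + 1)⁻¹ * ∑ i, ((if j i = l then 1 else 0) - p l) := by
    intro j l
    have h1 : (vertexMap j (barycenterPoint N)) l =
        ∑ i ∈ Finset.univ.filter (fun i => j i = l), ((N : ℝ) + 1)⁻¹ :=
      FunOnFinite.linearMap_apply_apply ℝ ℝ j (barycenterPoint N) l
    rw [h1, Finset.sum_sub_distrib, Finset.sum_const, Finset.sum_const, Finset.card_univ,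
      Fintype.card_fin, Finset.sum_ite, Finset.sum_const_zero, Finset.sum_const, mul_sub]
    simp only [nsmul_eq_mul, mul_one, add_zero, Nat.cast_add_one]
    rw [inv_mul_cancel_left₀ hN, mul_comm]
  simp only [hmean, mul_pow]
  simp only [Finset.mul_sum]
  rw [Finset.sum_comm]
  have hl : ∀ l, ∑ j : Fin (N + 1) → I, (∏ i, p (j i)) *
      ((((N : ℝ) + 1)⁻¹) ^ 2 * (∑ i, ((if j i = l then 1 else 0) - p l)) ^ 2) ≤
        ((N : ℝ) + 1)⁻¹ * p l := by
    intro l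
    have hp : ∑ i, p i * ((if i = l then 1 else 0) - p l) = 0 := by
      simp [mul_sub, Finset.sum_sub_distrib, ← Finset.sum_mul]
    have h2 : ∑ i, p i * ((if i = l then 1 else 0) - p l) ^ 2 ≤ p l := by
      have : ∀ i, p i * ((if i = l then 1 else 0) - p l) ^ 2 =
          (if i = l then p i else 0) * (1 - 2 * p l) + p i * p l ^ 2 := by
        intro i
        split_ifs <;> ring
      simp only [this, Finset.sum_add_distrib, ← Finset.sum_mul, stdSimplex.sum_eq_one]
      rw [Finset.sum_ite_eq' Finset.univ l, if_pos (Finset.mem_univ l)]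
      nlinarith [sq_nonneg (p l)]
    have h3 := sum_weights_mul_sum_sq p (fun i => (if i = l then 1 else 0) - p l) hp (N + 1)
    simp only [mul_left_comm _ (((N : ℝ) + 1)⁻¹ ^ 2), ← Finset.mul_sum]
    rw [h3, Nat.cast_add_one, sq, mul_assoc, inv_mul_cancel_left₀ hN]
    exact mul_le_mul_of_nonneg_left h2 (by positivity)
  refine (Finset.sum_le_sum fun l _ => hl l).trans ?_
  rw [← Finset.mul_sum, stdSimplex.sum_eq_one, mul_one]

/-- Bernstein's theorem on a simplex: uniform approximation by Bernstein polynomials. -/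
lemma eventually_bernsteinForm_dist_lt {W : Type*} [NormedAddCommGroup W] [NormedSpace ℝ W]
    (F : C(stdSimplex ℝ I, W)) {ε : ℝ} (hε : 0 < ε) :
    ∀ᶠ N in Filter.atTop, ∀ p : stdSimplex ℝ I, ‖bernsteinForm N F p - F p‖ < ε := by
  have huc : UniformContinuous F := CompactSpace.uniformContinuous_of_continuous F.continuous
  obtain ⟨δ, hδ, hF⟩ := Metric.uniformContinuous_iff.1 huc (ε / 2) (half_pos hε)
  obtain ⟨M, hM⟩ := (isCompact_range F.continuous).isBounded.exists_norm_le
  -- Chebyshev's estimate: close to `p` uniform continuity gives `ε / 2`, and away from `p` some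
  -- coordinate differs by at least `δ`, so the quadratic term exceeds the trivial bound `2 * |M|`.
  have hpq : ∀ p q, ‖F q - F p‖ ≤ ε / 2 + 2 * |M| / δ ^ 2 * ∑ l, (q l - p l) ^ 2 := by
    intro p q
    have hs : 0 ≤ ∑ l, (q l - p l) ^ 2 := Finset.sum_nonneg fun l _ => sq_nonneg _
    by_cases h : dist q p < δ
    · have := hF h
      rw [dist_eq_norm] at this
      have : 0 ≤ 2 * |M| / δ ^ 2 * ∑ l, (q l - p l) ^ 2 := by positivity
      linarith
    · have hl : ∃ l, δ ≤ dist (q l) (p l) := by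
        by_contra! hl
        exact h ((dist_pi_lt_iff hδ).2 hl)
      obtain ⟨l, hl⟩ := hl
      have h1 : δ ^ 2 ≤ ∑ l, (q l - p l) ^ 2 := by
        refine le_trans ?_ (Finset.single_le_sum (f := fun l => (q l - p l) ^ 2)
          (fun l _ => sq_nonneg _) (Finset.mem_univ l))
        rw [← sq_abs (q l - p l)]
        exact pow_le_pow_left₀ hδ.le hl 2
      have h2 : 2 * |M| ≤ 2 * |M| / δ ^ 2 * ∑ l, (q l - p l) ^ 2 := by
        rw [div_mul_eq_mul_div, le_div_iff₀ (by positivity)]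
        exact mul_le_mul_of_nonneg_left h1 (by positivity)
      have h3 : ‖F q - F p‖ ≤ 2 * |M| := by
        refine (norm_sub_le _ _).trans ?_
        have := (hM _ (Set.mem_range_self q)).trans (le_abs_self M)
        have := (hM _ (Set.mem_range_self p)).trans (le_abs_self M)
        linarith
      linarith [half_pos hε]
  have hlim : Filter.Tendsto (fun N : ℕ => 2 * |M| / δ ^ 2 * ((N : ℝ) + 1)⁻¹) Filter.atTop
      (nhds 0) := by
    have := (tendsto_one_div_add_atTop_nhds_zero_nat (𝕜 := ℝ)).const_mul (2 * |M| / δ ^ 2)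
    simpa using this
  filter_upwards [hlim.eventually_lt_const (half_pos hε)] with N hN p
  have hw : ∀ j : Fin (N + 1) → I, 0 ≤ ∏ i, p (j i) :=
    fun j => Finset.prod_nonneg fun i _ => stdSimplex.zero_le _ _
  have h1 : bernsteinForm N F p - F p =
      ∑ j : Fin (N + 1) → I, (∏ i, p (j i)) • (F (vertexMap j (barycenterPoint N)) - F p) := by
    simp only [smul_sub, Finset.sum_sub_distrib, ← Finset.sum_smul, sum_prod_weights, one_smul]
    rfl
  rw [h1]
  calc _ ≤ ∑ j : Fin (N + 1) → I, (∏ i, p (j i)) * (ε / 2 + 2 * |M| / δ ^ 2 *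
        ∑ l, ((vertexMap j (barycenterPoint N)) l - p l) ^ 2) := by
        refine (norm_sum_le _ _).trans (Finset.sum_le_sum fun j _ => ?_)
        rw [norm_smul, Real.norm_of_nonneg (hw j)]
        exact mul_le_mul_of_nonneg_left (hpq _ _) (hw j)
    _ = ε / 2 + 2 * |M| / δ ^ 2 * ∑ j : Fin (N + 1) → I, (∏ i, p (j i)) *
        ∑ l, ((vertexMap j (barycenterPoint N)) l - p l) ^ 2 := by
        simp only [mul_add, Finset.sum_add_distrib, ← Finset.sum_mul, sum_prod_weights, one_mul]
        rw [Finset.mul_sum]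
        congr 1
        exact Finset.sum_congr rfl fun j _ => by ring
    _ ≤ ε / 2 + 2 * |M| / δ ^ 2 * ((N : ℝ) + 1)⁻¹ := by
        gcongr
        exact sum_weights_mul_mean_sub_sq_le p N
    _ < ε := by linarith

/-- A nowhere vanishing map on a simplex is joined to its Bernstein polynomials of large degree by a
straight line of nowhere vanishing maps. -/
lemma eventually_line_bernsteinForm_ne_zero {V : Type*} [AddCommGroup V] [Module ℝ V]
    [TopologicalSpace V] [IsTopologicalAddGroup V] [ContinuousSMul ℝ V] [T2Space V]
    [FiniteDimensional ℝ V] (F : C(stdSimplex ℝ I, V)) (hF : ∀ p, F p ≠ 0) :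
    ∀ᶠ N in Filter.atTop, ∀ p : stdSimplex ℝ I, ∀ t ∈ Set.Icc (0 : ℝ) 1,
      (1 - t) • F p + t • bernsteinForm N F p ≠ 0 := by
  let L : V ≃ₗ[ℝ] (Fin (Module.finrank ℝ V) → ℝ) := LinearEquiv.ofFinrankEq _ _ (by simp)
  have hL : Continuous L := L.toLinearMap.continuous_of_finiteDimensional
  let F' : C(stdSimplex ℝ I, Fin (Module.finrank ℝ V) → ℝ) := ⟨fun p => L (F p), hL.comp F.continuous⟩
  rcases isEmpty_or_nonempty (stdSimplex ℝ I) with hI | hI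
  · exact Filter.Eventually.of_forall fun N p => (hI.false p).elim
  obtain ⟨p₀, -, hp₀⟩ := isCompact_univ.exists_isMinOn (Set.univ_nonempty)
    (F'.continuous.norm).continuousOn
  have hpos : 0 < ‖F' p₀‖ := norm_pos_iff.2 fun h => hF p₀ (L.map_eq_zero_iff.1 h)
  filter_upwards [eventually_bernsteinForm_dist_lt F' hpos] with N hN p t ht h0
  -- A zero of the line forces `F'` to be no larger than the approximation error, which is below the
  -- minimum of its norm.
  have h1 : F' p = -(t • (bernsteinForm N F' p - F' p)) := by
    have h := congrArg L h0
    rw [map_add, map_smul, map_smul, map_zero,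
      show L (bernsteinForm N F p) = bernsteinForm N F' p from
        bernsteinForm_map_linear N L.toLinearMap F p] at h
    rw [← sub_eq_zero, sub_neg_eq_add, ← h]
    change F' p + _ = (1 - t) • F' p + _
    module
  have h2 : ‖F' p‖ < ‖F' p₀‖ := by
    rw [h1, norm_neg, norm_smul, Real.norm_of_nonneg ht.1]
    exact (mul_le_of_le_one_left (norm_nonneg _) ht.2).trans_lt (hN p)
  exact absurd (hp₀ (Set.mem_univ p)) (not_le.2 h2)

end Bernstein

/-! ### Vectors in general position -/

section GeneralPosition

lemma contDiff_bernsteinForm {V I : Type*} [AddCommGroup V] [Module ℝ V]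
    [Fintype I] (N : ℕ) (F : stdSimplex ℝ I → V)
    (φ : V →ₗ[ℝ] ℝ) : ContDiff ℝ 1 fun y => φ (bernsteinForm N F y) := by
  simp only [bernsteinForm, map_sum, map_smul, smul_eq_mul]
  exact ContDiff.sum fun j _ => (contDiff_prod fun i _ => contDiff_apply ℝ ℝ _).mul contDiff_const

variable {V : Type*} [AddCommGroup V] [Module ℝ V] [FiniteDimensional ℝ V]

/-- Finitely many images of spaces of dimension less than `dim V` under `C^1` maps do not
cover `V`. -/
lemma exists_notMem_range_of_contDiff {J : Type*} [Finite J] {E : J → Type*}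
    [∀ j, NormedAddCommGroup (E j)] [∀ j, NormedSpace ℝ (E j)] [∀ j, FiniteDimensional ℝ (E j)]
    (f : ∀ j, E j → V) (hf : ∀ j (φ : V →ₗ[ℝ] ℝ), ContDiff ℝ 1 fun x => φ (f j x))
    (hE : ∀ j, Module.finrank ℝ (E j) < Module.finrank ℝ V) :
    ∃ v, ∀ j, v ∉ Set.range (f j) := by
  let L : V ≃ₗ[ℝ] (Fin (Module.finrank ℝ V) → ℝ) := LinearEquiv.ofFinrankEq _ _ (by simp)
  have hc : ∀ j, ContDiff ℝ 1 fun x => L (f j x) := fun j =>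
    contDiff_pi.2 fun i => hf j (LinearMap.proj i ∘ₗ L.toLinearMap)
  rcases isEmpty_or_nonempty J with hJ | hJ
  · exact ⟨0, fun j => hJ.elim j⟩
  have hd : dimH (⋃ j, Set.range fun x => L (f j x)) <
      Module.finrank ℝ (Fin (Module.finrank ℝ V) → ℝ) := by
    rw [dimH_iUnion]
    obtain ⟨j₀, hj₀⟩ := Finite.exists_max fun j => dimH (Set.range fun x => L (f j x))
    -- A `C^1` map does not raise Hausdorff dimension above that of its source, and a finite union
    -- has the maximal dimension of its members.
    refine (iSup_le hj₀).trans_lt (((hc j₀).dimH_range_le).trans_lt ?_)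
    rw [Module.finrank_fin_fun]
    exact_mod_cast hE j₀
  obtain ⟨y, hy⟩ := (dense_compl_of_dimH_lt_finrank hd).nonempty
  refine ⟨L.symm y, fun j ⟨x, hx⟩ => hy (Set.mem_iUnion.2 ⟨j, x, ?_⟩)⟩
  simp [hx]

/-- The parameter `z none` is the coefficient of `Q j`; the parameters `z (some i)` are the
coefficients of the vectors `L j i (w (o j i))`. For a suitable choice of `w` no non-trivial
combination with at most `dim V` non-zero parameters vanishes. -/
lemma exists_generic_weights {Ω J I : Type*} [Finite J] [Fintype I] (o : J → I → Ω)
    (ho : ∀ j, Function.Injective (o j)) (L : J → I → V ≃ₗ[ℝ] V) (Q : J → (I → ℝ) → V) (d : ℕ)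
    (hQ : ∀ j (φ : V →ₗ[ℝ] ℝ), ContDiff ℝ 1 fun y => φ (Q j y))
    (hd : ∀ j (r : ℝ) y, Q j (r • y) = r ^ d • Q j y) :
    ∃ w : Ω → V, ∀ j (z : Option I → ℝ), (∃ i, z (some i) ≠ 0) →
      {k | z k ≠ 0}.ncard ≤ Module.finrank ℝ V →
      z none • Q j (fun i => z (some i)) + ∑ i, z (some i) • L j i (w (o j i)) ≠ 0 := by
  classical
  -- The vectors are chosen one label at a time: `A` holds the labels treated so far, and the claim
  -- concerns only combinations whose non-zero parameters have labels in `A`.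
  have key : ∀ A : Finset Ω, ∃ w : Ω → V, ∀ j (z : Option I → ℝ), (∃ i, z (some i) ≠ 0) →
      (∀ i, z (some i) ≠ 0 → o j i ∈ A) → {k | z k ≠ 0}.ncard ≤ Module.finrank ℝ V →
      z none • Q j (fun i => z (some i)) + ∑ i, z (some i) • L j i (w (o j i)) ≠ 0 := by
    intro A
    induction A using Finset.induction_on with
    | empty => exact ⟨0, fun j z ⟨i, hi⟩ h => absurd (h i hi) (Finset.notMem_empty _)⟩
    | insert r A hr ih =>
      obtain ⟨w, hw⟩ := ih
      -- A degenerate combination involving the new vector is recorded by its configuration, the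
      -- position of that vector, and the set of remaining non-zero parameters, of which there are
      -- fewer than `dim V`.
      let B := {b : J × I × Finset (Option I) // b.2.2.card < Module.finrank ℝ V}
      have : Finite B := Subtype.finite
      let ext (S : Finset (Option I)) (x : S → ℝ) (k : Option I) : ℝ :=
        if h : k ∈ S then x ⟨k, h⟩ else 0
      have hext : ∀ S k, ContDiff ℝ 1 fun x => ext S x k := by
        intro S k
        by_cases h : k ∈ S
        · simp only [ext, dif_pos h]
          exact contDiff_apply ℝ ℝ _
        · simp only [ext, dif_neg h]
          exact contDiff_const
      -- This is the new vector solved from a vanishing combination in which its own parameter is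
      -- normalized to `1`.
      let bad (b : B) (x : b.1.2.2 → ℝ) : V := (L b.1.1 b.1.2.1).symm
        (-(ext _ x none • Q b.1.1 (Function.update (fun i => ext _ x (some i)) b.1.2.1 1) +
          ∑ i ∈ Finset.univ.erase b.1.2.1, ext _ x (some i) • L b.1.1 i (w (o b.1.1 i))))
      obtain ⟨v, hv⟩ := exists_notMem_range_of_contDiff bad (by
        rintro ⟨⟨j, i₀, S⟩, hS⟩ φ
        have h1 : ContDiff ℝ 1 fun x : S → ℝ => (φ ∘ₗ (L j i₀).symm.toLinearMap)
            (Q j (Function.update (fun i => ext S x (some i)) i₀ 1)) := by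
          refine (hQ j (φ ∘ₗ (L j i₀).symm.toLinearMap)).comp (contDiff_pi.2 fun i => ?_)
          by_cases hi : i = i₀
          · subst hi
            simp only [Function.update_self]
            exact contDiff_const
          · simp only [Function.update_of_ne hi]
            exact hext S _
        simp only [bad, map_neg, map_add, map_sum, map_smul, smul_eq_mul]
        exact (((hext S none).mul h1).add
          (ContDiff.sum fun i _ => (hext S _).mul contDiff_const)).neg)
        (fun b => by simpa using b.2)
      refine ⟨Function.update w r v, fun j z hz hA hn h0 => ?_⟩
      by_cases hi : ∃ i₀, z (some i₀) ≠ 0 ∧ o j i₀ = r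
      · obtain ⟨i₀, hi₀, rfl⟩ := hi
        let S : Finset (Option I) := (Finset.univ.filter fun k => z k ≠ 0).erase (some i₀)
        have hS : S.card < Module.finrank ℝ V := by
          refine (Finset.card_erase_lt_of_mem (by simpa using hi₀)).trans_le ?_
          rwa [← Set.ncard_coe_finset, Finset.coe_filter_univ]
        set c := (z (some i₀))⁻¹ with hc
        have hc0 : c ≠ 0 := inv_ne_zero hi₀
        -- Multiplying the relation by `c` makes the parameter at `i₀` equal to `1`. Since `Q` is
        -- homogeneous of degree `d`, rescaling its argument by `c` is offset by `(c ^ d)⁻¹` in its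
        -- coefficient.
        let x : S → ℝ := fun k => k.1.elim (z none * c * (c ^ d)⁻¹) fun i => c * z (some i)
        have hnone : ext S x none = z none * c * (c ^ d)⁻¹ := by
          by_cases h : none ∈ S
          · simp only [ext, dif_pos h, x, Option.elim]
          · have : z none = 0 := by
              by_contra h'
              exact h (Finset.mem_erase.2 ⟨by simp, by simpa using h'⟩)
            simp only [ext, dif_neg h, this, zero_mul]
        have hsome : ∀ i, i ≠ i₀ → ext S x (some i) = c * z (some i) := by
          intro i hii
          by_cases h : some i ∈ S
          · simp only [ext, dif_pos h, x, Option.elim]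
          · have : z (some i) = 0 := by
              by_contra h'
              exact h (Finset.mem_erase.2 ⟨by simpa using hii, by simpa using h'⟩)
            simp only [ext, dif_neg h, this, mul_zero]
        refine hv ⟨(j, i₀, S), hS⟩ ⟨x, ?_⟩
        simp only [bad]
        rw [LinearEquiv.symm_apply_eq, neg_eq_iff_add_eq_zero]
        have hupd : Function.update (fun i => ext S x (some i)) i₀ 1 =
            c • fun i => z (some i) := by
          funext i
          by_cases hii : i = i₀
          · subst hii
            simp [hc, hi₀]
          · simp [Function.update_of_ne hii, hsome i hii]
        have hsum : ∑ i ∈ Finset.univ.erase i₀, ext S x (some i) • L j i (w (o j i)) =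
            c • ∑ i ∈ Finset.univ.erase i₀,
              z (some i) • L j i (Function.update w (o j i₀) v (o j i)) := by
          rw [Finset.smul_sum]
          refine Finset.sum_congr rfl fun i hi => ?_
          have hne := Finset.ne_of_mem_erase hi
          rw [hsome i hne, Function.update_of_ne fun h => hne (ho j h), mul_smul]
        have h1 : L j i₀ v = c • z (some i₀) •
            L j i₀ (Function.update w (o j i₀) v (o j i₀)) := by
          rw [Function.update_self, smul_smul, hc, inv_mul_cancel₀ hi₀, one_smul]
        rw [hupd, hd, hnone, hsum, smul_smul, inv_mul_cancel_right₀ (pow_ne_zero d hc0),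
          mul_comm (z none), mul_smul, h1, add_assoc, ← smul_add, add_comm (Finset.sum _ _),
          Finset.add_sum_erase Finset.univ
            (fun i => z (some i) • L j i (Function.update w (o j i₀) v (o j i)))
            (Finset.mem_univ i₀), ← smul_add, h0, smul_zero]
      -- If the new label does not occur among the non-zero parameters, replacing its vector changes
      -- nothing.
      · refine hw j z hz (fun i hzi => ?_) hn ?_
        · exact (Finset.mem_insert.1 (hA i hzi)).resolve_left fun h => hi ⟨i, hzi, h⟩
        · rw [← h0]
          congr 1
          refine Finset.sum_congr rfl fun i _ => ?_
          by_cases hzi : z (some i) = 0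
          · rw [hzi, zero_smul, zero_smul]
          · rw [Function.update_of_ne fun h => hi ⟨i, hzi, h⟩]
  have := Fintype.ofFinite J
  obtain ⟨w, hw⟩ := key (Finset.univ.biUnion fun j => Finset.univ.image (o j))
  exact ⟨w, fun j z hz => hw j z hz fun i _ => Finset.mem_biUnion.2
    ⟨j, Finset.mem_univ j, Finset.mem_image_of_mem _ (Finset.mem_univ i)⟩⟩

end GeneralPosition

/-! ### Choosing signs -/

section Signs

variable {V : Type*} [AddCommGroup V] [Module ℝ V]

/-- If any `dim V` of the vectors `b i`, of which there are `dim V + 1`, are linearly independent,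
then `0` lies in the convex hull of the vectors `± b i` for at most two opposite choices of
signs. -/
lemma signs_eq_of_zero_mem_hull {I : Type*} [Fintype I] (b : I → V)
    (hI : Fintype.card I = Module.finrank ℝ V + 1)
    (hb : ∀ y : I → ℝ, y ≠ 0 → {i | y i ≠ 0}.ncard ≤ Module.finrank ℝ V → ∑ i, y i • b i ≠ 0)
    {ε ε' : I → ℤˣ} (p p' : stdSimplex ℝ I)
    (hp : ∑ i, (p i * ((ε i : ℤ) : ℝ)) • b i = 0) (hp' : ∑ i, (p' i * ((ε' i : ℤ) : ℝ)) • b i = 0)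
    (i₀ : I) (h₀ : ε i₀ = ε' i₀) : ε = ε' := by
  classical
  have hunit : ∀ e : ℤˣ, ((e : ℤ) : ℝ) ≠ 0 := fun e => by exact_mod_cast e.ne_zero
  -- A linear relation with one zero coefficient involves at most `dim V` vectors, hence is trivial.
  have hsmall : ∀ y : I → ℝ, ∑ i, y i • b i = 0 → ∀ i, y i = 0 → y = 0 := by
    intro y hy i hi
    by_contra hne
    refine hb y hne ?_ hy
    have : {i | y i ≠ 0} ⊆ ((Finset.univ.erase i : Finset I) : Set I) := by
      intro k hk
      simp only [Finset.coe_erase, Finset.coe_univ, Set.mem_sdiff, Set.mem_univ, true_and,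
        Set.mem_singleton_iff]
      rintro rfl
      exact hk hi
    refine (Set.ncard_le_ncard this (Finset.finite_toSet _)).trans ?_
    rw [Set.ncard_coe_finset, Finset.card_erase_of_mem (Finset.mem_univ i), Finset.card_univ, hI,
      Nat.add_sub_cancel]
  have hpos : ∀ (q : stdSimplex ℝ I) (e : I → ℤˣ),
      ∑ i, (q i * ((e i : ℤ) : ℝ)) • b i = 0 → ∀ i, 0 < q i := by
    intro q e hq i
    refine lt_of_le_of_ne (stdSimplex.zero_le q i) fun h => ?_
    have hz := hsmall _ hq i (by rw [← h, zero_mul])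
    have hq0 : ∀ k, q k = 0 := fun k =>
      (mul_eq_zero.1 (congrFun hz k)).resolve_right (hunit _)
    have := stdSimplex.sum_eq_one q
    simp [hq0] at this
  -- This combination of the two relations cancels at `i₀`, so they are proportional with a positive
  -- factor, and their signs agree.
  have hprop : (fun i => p' i₀ * (p i * ((ε i : ℤ) : ℝ)) - p i₀ * (p' i * ((ε' i : ℤ) : ℝ))) = 0 := by
    refine hsmall _ ?_ i₀ (by rw [h₀]; ring)
    simp only [sub_smul, mul_smul (p' i₀), mul_smul (p i₀), Finset.sum_sub_distrib,
      ← Finset.smul_sum]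
    rw [hp, hp', smul_zero, smul_zero, sub_zero]
  funext i
  have h := sub_eq_zero.1 (congrFun hprop i)
  have h1 := mul_pos (hpos p' _ hp' i₀) (hpos p _ hp i)
  have h2 := mul_pos (hpos p _ hp i₀) (hpos p' _ hp' i)
  rcases Int.units_eq_one_or (ε i) with e | e <;> rcases Int.units_eq_one_or (ε' i) with e' | e' <;>
    rw [e, e'] at h ⊢ <;> simp at h <;> exfalso <;> linarith

/-- If each of fewer than `2 ^ n` constraints excludes only choices of signs that are determined by
their values off a set of `n` elements, then some choice of signs satisfies all constraints. -/
lemma exists_signs {R T : Type*} [Fintype R] [Fintype T] (n : ℕ) (hT : Fintype.card T < 2 ^ n)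
    (bad : T → Set (R → ℤˣ)) (S : T → Finset R) (hS : ∀ t, (S t).card = n)
    (h : ∀ t, ∀ ε ∈ bad t, ∀ ε' ∈ bad t, (∀ r ∉ S t, ε r = ε' r) → ε = ε') :
    ∃ ε : R → ℤˣ, ∀ t, ε ∉ bad t := by
  classical
  by_contra! hcon
  have hcard : ∀ t, (bad t).toFinset.card * 2 ^ n ≤ 2 ^ Fintype.card R := by
    intro t
    -- Restriction to the complement of `S t` is injective on the bad choices, so at most `2 ^ (|R|
    -- - n)` are bad for `t`.
    have h1 : (bad t).toFinset.card ≤ Fintype.card ({r // r ∉ S t} → ℤˣ) := by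
      rw [← Finset.card_univ]
      refine Finset.card_le_card_of_injOn (fun ε r => ε r.1) (fun _ _ => Finset.mem_coe.2 (Finset.mem_univ _)) ?_
      intro ε hε ε' hε' he
      exact h t ε (by simpa using hε) ε' (by simpa using hε')
        fun r hr => congrFun he ⟨r, hr⟩
    have h2 : Fintype.card ({r // r ∉ S t} → ℤˣ) * 2 ^ n = 2 ^ Fintype.card R := by
      rw [Fintype.card_fun, Fintype.card_units_int, ← pow_add, Fintype.card_subtype_compl,
        Fintype.card_coe, hS, Nat.sub_add_cancel]
      rw [← hS t]
      exact Finset.card_le_univ _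
    rw [← h2]
    exact Nat.mul_le_mul_right _ h1
  have htot : 2 ^ Fintype.card R ≤ ∑ t, (bad t).toFinset.card := by
    have h1 : (Finset.univ : Finset (R → ℤˣ)) ⊆ Finset.univ.biUnion fun t => (bad t).toFinset := by
      intro ε _
      obtain ⟨t, ht⟩ := hcon ε
      exact Finset.mem_biUnion.2 ⟨t, Finset.mem_univ t, by simpa using ht⟩
    have h2 := (Finset.card_le_card h1).trans Finset.card_biUnion_le
    rwa [Finset.card_univ, Fintype.card_fun, Fintype.card_units_int] at h2
  have h3 : 2 ^ Fintype.card R * 2 ^ n ≤ Fintype.card T * 2 ^ Fintype.card R := by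
    calc _ ≤ (∑ t, (bad t).toFinset.card) * 2 ^ n := Nat.mul_le_mul_right _ htot
      _ = ∑ t, (bad t).toFinset.card * 2 ^ n := Finset.sum_mul _ _ _
      _ ≤ ∑ _t : T, 2 ^ Fintype.card R := Finset.sum_le_sum fun t _ => hcard t
      _ = _ := by simp
  rw [mul_comm] at h3
  exact absurd (Nat.le_of_mul_le_mul_right h3 (by positivity)) (not_le.2 hT)

end Signs

/-! ### Vertices of simplices and the sections they define -/

section Vertices

lemma continuous_stdSimplex_apply {I : Type*} [Fintype I] (i : I) :
    Continuous fun p : stdSimplex ℝ I => p i :=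
  (continuous_apply i).comp continuous_subtype_val

lemma sum_vertexMap_smul {I I' M : Type*} [Fintype I] [Fintype I'] [AddCommGroup M] [Module ℝ M]
    (θ : I → I') (p : stdSimplex ℝ I) (b : I' → M) :
    ∑ l, (vertexMap θ p) l • b l = ∑ i, p i • b (θ i) := by
  classical
  have h : ∀ l, (vertexMap θ p) l = ∑ i ∈ Finset.univ.filter (fun i => θ i = l), p i :=
    fun l => FunOnFinite.linearMap_apply_apply ℝ ℝ θ p l
  simp only [h, Finset.sum_smul]
  rw [← Finset.sum_fiberwise Finset.univ θ]
  refine Finset.sum_congr rfl fun l _ => Finset.sum_congr rfl fun i hi => ?_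
  rw [(Finset.mem_filter.1 hi).2]

lemma continuous_bernsteinForm {I V : Type*} [Fintype I] [AddCommGroup V] [Module ℝ V]
    [TopologicalSpace V] [IsTopologicalAddGroup V] [ContinuousSMul ℝ V] (N : ℕ) (F : stdSimplex ℝ I → V) :
    Continuous fun p : stdSimplex ℝ I => bernsteinForm N F p :=
  continuous_finsetSum _ fun _ _ =>
    (continuous_finsetProd _ fun _ _ => continuous_stdSimplex_apply _).smul continuous_const

variable {G : Type w} [Group G] {X : SSet.{u}} (a : G →* End X)

/-- The `i`-th vertex of a simplex. -/
def simplexVertex {k : ℕ} (x : X.obj (op (SimplexCategory.mk k))) (i : Fin (k + 1)) :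
    X.obj (op (SimplexCategory.mk 0)) :=
  X.map (SimplexCategory.const (SimplexCategory.mk 0) (SimplexCategory.mk k) i).op x

lemma simplexVertex_map {m k : ℕ} (θ : SimplexCategory.mk m ⟶ SimplexCategory.mk k)
    (x : X.obj (op (SimplexCategory.mk k))) (i : Fin (m + 1)) :
    simplexVertex (X.map θ.op x) i = simplexVertex x (θ.toOrderHom i) := by
  change (X.map θ.op ≫ X.map _) x = _
  rw [← X.map_comp, ← op_comp, SimplexCategory.const_comp]
  rfl

lemma app_map (g : G) {m k : ℕ} (θ : SimplexCategory.mk m ⟶ SimplexCategory.mk k)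
    (x : X.obj (op (SimplexCategory.mk k))) :
    (a g).app (op (SimplexCategory.mk m)) (X.map θ.op x) =
      X.map θ.op ((a g).app (op (SimplexCategory.mk k)) x) :=
  NatTrans.naturality_apply (a g) θ.op x

lemma simplexVertex_app (g : G) {k : ℕ} (x : X.obj (op (SimplexCategory.mk k)))
    (i : Fin (k + 1)) :
    simplexVertex ((a g).app (op (SimplexCategory.mk k)) x) i =
      (a g).app (op (SimplexCategory.mk 0)) (simplexVertex x i) :=
  (app_map a g _ x).symm

/-- The action on `k`-simplices of a group acting on a simplicial set. -/
@[reducible]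
def simplexAction (k : ℕ) : MulAction G (X.obj (op (SimplexCategory.mk k))) where
  smul g x := (a g).app (op (SimplexCategory.mk k)) x
  one_smul x := by
    change (a 1).app _ x = x
    rw [map_one]
    rfl
  mul_smul g h x := by
    change (a (g * h)).app _ x = (a g).app _ ((a h).app _ x)
    rw [map_mul, End.mul_def]
    rfl

lemma app_inv_app (g : G) {k : ℕ} (x : X.obj (op (SimplexCategory.mk k))) :
    (a g⁻¹).app (op (SimplexCategory.mk k)) ((a g).app (op (SimplexCategory.mk k)) x) = x :=
  letI := simplexAction a k
  inv_smul_smul g x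

lemma app_mem_nonDegenerate_iff (g : G) {k : ℕ} (x : X.obj (op (SimplexCategory.mk k))) :
    (a g).app (op (SimplexCategory.mk k)) x ∈ X.nonDegenerate k ↔ x ∈ X.nonDegenerate k := by
  have h : ∀ (g : G) (x : X.obj (op (SimplexCategory.mk k))), x ∈ X.degenerate k →
      (a g).app (op (SimplexCategory.mk k)) x ∈ X.degenerate k := by
    rintro g x ⟨m, hm, θ, y, rfl⟩
    exact ⟨m, hm, θ, (a g).app (op (SimplexCategory.mk m)) y, (app_map a g θ y).symm⟩
  refine not_congr ⟨fun hx => ?_, h g x⟩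
  have := h g⁻¹ _ hx
  rwa [app_inv_app] at this

/-- The two faces of `X.σ j y` that undo the degeneracy equal `y` and occur with opposite signs;
every other face still has a repeated vertex, where `c` vanishes. -/
lemma coboundary_degenerate {A : Type v} [AddCommGroup A] {α : Representation ℤ G A} {m : ℕ}
    (c : equivCochains a α m)
    (hc : ∀ x, ¬ Function.Injective (simplexVertex x) → c.1 x = 0)
    (j : Fin (m + 1)) (y : X.obj (op (SimplexCategory.mk m))) :
    (coboundary a α m c).1 (X.σ j y) = 0 := by
  change ∑ i : Fin (m + 2), ((-1 : ℤ) ^ (i : ℕ)) • c.1 (X.δ i (X.σ j y)) = 0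
  rw [Finset.sum_eq_add j.castSucc j.succ (Fin.castSucc_lt_succ).ne]
  · rw [SSet.δ_comp_σ_self_apply, SSet.δ_comp_σ_succ_apply, ← add_smul, Fin.val_castSucc,
      Fin.val_succ, pow_succ, mul_neg_one, add_neg_cancel, zero_smul]
  · rintro i - ⟨h1, h2⟩
    rw [hc, smul_zero]
    intro hinj
    obtain ⟨k₁, hk₁⟩ := Fin.exists_succAbove_eq h1.symm
    obtain ⟨k₂, hk₂⟩ := Fin.exists_succAbove_eq h2.symm
    have hv : ∀ k, simplexVertex (X.δ i (X.σ j y)) k =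
        simplexVertex y (j.predAbove (i.succAbove k)) := by
      intro k
      refine (simplexVertex_map (SimplexCategory.δ i) (X.σ j y) k).trans ?_
      exact simplexVertex_map (SimplexCategory.σ j) y _
    have : k₁ = k₂ := hinj (by
      rw [hv, hv, hk₁, hk₂, Fin.predAbove_castSucc_self, Fin.predAbove_succ_self])
    rw [← this, hk₁] at hk₂
    exact (Fin.castSucc_lt_succ).ne hk₂
  · simp
  · simp

/-- By freeness, each point is a unique translate of the chosen representative of its orbit; `γ` is
the translating element. -/
lemma exists_equivariant_section {S : Type*} [MulAction G S]
    (hS : ∀ (s : S) (g : G), g • s = s → g = 1) :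
    ∃ γ : S → G, ∀ g s, γ (g • s) = g * γ s := by
  have h : ∀ s : S, ∃ g : G, g • (Quotient.out (Quotient.mk (MulAction.orbitRel G S) s)) = s := by
    intro s
    exact MulAction.orbitRel_apply.1
      ((MulAction.orbitRel G S).symm (Quotient.mk_out (s := MulAction.orbitRel G S) s))
  choose γ hγ using h
  refine ⟨γ, fun g s => ?_⟩
  have hq : Quotient.mk (MulAction.orbitRel G S) (g • s) =
      Quotient.mk (MulAction.orbitRel G S) s := Quotient.sound ⟨g, rfl⟩
  have h1 := hγ (g • s)
  rw [hq] at h1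
  have h2 : (g * γ s) • (Quotient.out (Quotient.mk (MulAction.orbitRel G S) s)) = g • s := by
    rw [mul_smul, hγ]
  have h3 := hS (Quotient.out (Quotient.mk (MulAction.orbitRel G S) s))
    ((g * γ s)⁻¹ * γ (g • s)) (by rw [mul_smul, h1, ← h2, inv_smul_smul])
  exact (inv_mul_eq_one.1 h3).symm

variable {V : Type v} [AddCommGroup V] [Module ℝ V] [TopologicalSpace V] [IsTopologicalAddGroup V]
  [ContinuousSMul ℝ V] [T2Space V] [FiniteDimensional ℝ V] {ρ : Representation ℝ G V} {a}

/-- The equivariant map, affine on each simplex, given by an equivariant map on vertices. -/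
def affineSection (φ : X.obj (op (SimplexCategory.mk 0)) → V)
    (hφ : ∀ (g : G) x, φ ((a g).app (op (SimplexCategory.mk 0)) x) = ρ g (φ x)) :
    SkeletalSection ρ a 0 where
  toFun k x := ⟨fun p => ∑ i, p i • φ (simplexVertex x i),
    continuous_finsetSum _ fun i _ => (continuous_stdSimplex_apply i).smul continuous_const⟩
  compat θ x := by
    ext p
    simp only [ContinuousMap.coe_mk, ContinuousMap.comp_apply, simplexVertex_map]
    exact (sum_vertexMap_smul (θ.toOrderHom) p fun l => φ (simplexVertex x l)).symm
  equivariant g k x := by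
    ext p
    simp [simplexVertex_app, hφ, actionMap]
  ne_zero k hk := absurd hk (Nat.not_lt_zero k)

/-- The Bernstein approximation of an equivariant map. -/
def bernsteinSection {n : ℕ} (f : SkeletalSection ρ a n) (N : ℕ) : SkeletalSection ρ a 0 where
  toFun k x := ⟨fun p => bernsteinForm N (f.toFun k x) p, continuous_bernsteinForm N _⟩
  compat θ x := by
    ext p
    rw [ContinuousMap.coe_mk, f.compat]
    exact (bernsteinForm_comp_map N θ.toOrderHom (f.toFun _ x) p).symm
  equivariant g k x := by
    ext p
    rw [ContinuousMap.coe_mk, f.equivariant]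
    exact (bernsteinForm_map_linear N (ρ g) (f.toFun k x) p).symm
  ne_zero k hk := absurd hk (Nat.not_lt_zero k)

lemma LineNeZero.map {n₀ n₁ m k : ℕ} {f₀ : SkeletalSection ρ a n₀} {f₁ : SkeletalSection ρ a n₁}
    {x : X.obj (op (SimplexCategory.mk k))} (h : LineNeZero f₀ f₁ x)
    (θ : SimplexCategory.mk m ⟶ SimplexCategory.mk k) : LineNeZero f₀ f₁ (X.map θ.op x) := by
  intro p t ht
  rw [f₀.compat, f₁.compat]
  exact h _ t ht

lemma LineNeZero.right {n₀ n₁ k : ℕ} {f₀ : SkeletalSection ρ a n₀} {f₁ : SkeletalSection ρ a n₁}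
    {x : X.obj (op (SimplexCategory.mk k))} (h : LineNeZero f₀ f₁ x) (p) :
    f₁.toFun k x p ≠ 0 := by
  have := h p 1 ⟨zero_le_one, le_rfl⟩
  rwa [sub_self, zero_smul, zero_add, one_smul] at this

end Vertices

/-! ### Vanishing of the Euler class of a complex with few top-dimensional simplices -/

section Core

variable {G : Type w} [Group G]
  {V : Type v} [AddCommGroup V] [Module ℝ V] [TopologicalSpace V] [IsTopologicalAddGroup V]
  [ContinuousSMul ℝ V] [T2Space V] [FiniteDimensional ℝ V] {ρ : Representation ℝ G V}
  {X : SSet.{u}} {a : G →* End X}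

/-- The automorphism of a representation given by a group element. -/
def representationEquiv {G V : Type*} [Group G] [AddCommGroup V] [Module ℝ V]
    (ρ : Representation ℝ G V) (g : G) : V ≃ₗ[ℝ] V :=
  LinearEquiv.ofLinearMap (ρ g) (ρ g⁻¹)
    (by rw [← Module.End.mul_eq_comp, ← map_mul, mul_inv_cancel, map_one]; rfl)
    (by rw [← Module.End.mul_eq_comp, ← map_mul, inv_mul_cancel, map_one]; rfl)

lemma ncard_option_le {I : Type*} [Finite I] (z : Option I → ℝ) :
    {k | z k ≠ 0}.ncard ≤ {i | z (some i) ≠ 0}.ncard + 1 := by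
  have : {k | z k ≠ 0} ⊆ insert none (some '' {i | z (some i) ≠ 0}) := by
    rintro (_ | i) hk
    · exact Set.mem_insert _ _
    · exact Set.mem_insert_of_mem _ ⟨i, hk, rfl⟩
  refine (Set.ncard_le_ncard this (Set.toFinite _)).trans ((Set.ncard_insert_le _ _).trans ?_)
  rw [Set.ncard_image_of_injective _ (Option.some_injective _)]

lemma ncard_option_of_none {I : Type*} (z : Option I → ℝ) (h : z none = 0) :
    {k | z k ≠ 0}.ncard = {i | z (some i) ≠ 0}.ncard := by
  rw [← Set.ncard_image_of_injective _ (Option.some_injective I)]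
  congr 1
  ext k
  cases k <;> simp [h]

lemma ncard_vertexMap_support_le {k l : ℕ} (θ : Fin (k + 1) → Fin (l + 1))
    (p : stdSimplex ℝ (Fin (k + 1))) : {i | (vertexMap θ p) i ≠ 0}.ncard ≤ k + 1 := by
  classical
  have : {i | (vertexMap θ p) i ≠ 0} ⊆ θ '' Set.univ := by
    intro i hi
    by_contra h
    refine hi ((FunOnFinite.linearMap_apply_apply ℝ ℝ θ p i).trans (Finset.sum_eq_zero ?_))
    intro j hj
    exact absurd ⟨j, Set.mem_univ j, (Finset.mem_filter.1 hj).2⟩ h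
  refine (Set.ncard_le_ncard this (Set.toFinite _)).trans ((Set.ncard_image_le).trans ?_)
  simp

/-- A choice of vectors at the vertices, in general position, such that the resulting affine map
has no zeros on `(m+1)`-simplices, provided that these form few orbits. -/
lemma exists_affineSection_ne_zero {m : ℕ} (hn : Module.finrank ℝ V = m + 1)
    (hfree : ∀ (v : X.obj (op (SimplexCategory.mk 0))) (g : G),
      (a g).app (op (SimplexCategory.mk 0)) v = v → g = 1)
    (hinj : ∀ x ∈ X.nonDegenerate (m + 1), Function.Injective (simplexVertex x))
    (hdisj : ∀ x ∈ X.nonDegenerate (m + 1), ∀ (g : G) (i j : Fin (m + 2)),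
      (a g).app (op (SimplexCategory.mk 0)) (simplexVertex x i) = simplexVertex x j → g = 1)
    (hfin : (X.nonDegenerate (m + 1)).Finite)
    (hlt : {O : Set (X.obj (op (SimplexCategory.mk (m + 1)))) | ∃ x ∈ X.nonDegenerate (m + 1),
      O = Set.range fun g : G => (a g).app (op (SimplexCategory.mk (m + 1))) x}.encard < 2 ^ (m + 1))
    (f : SkeletalSection ρ a (m + 1)) (N : ℕ) :
    ∃ F : SkeletalSection ρ a 0,
      (∀ x ∈ X.nonDegenerate (m + 1), ∀ p, F.toFun (m + 1) x p ≠ 0) ∧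
      ∀ x ∈ X.nonDegenerate (m + 1), ∀ k < m,
        ∀ θ : SimplexCategory.mk k ⟶ SimplexCategory.mk (m + 1),
        (∀ p, (bernsteinSection f N).toFun k (X.map θ.op x) p ≠ 0) →
          LineNeZero (bernsteinSection f N) F (X.map θ.op x) := by
  classical
  let _ := simplexAction a 0
  let Ω := MulAction.orbitRel.Quotient G (X.obj (op (SimplexCategory.mk 0)))
  let orb (v : X.obj (op (SimplexCategory.mk 0))) : Ω := Quotient.mk _ v
  have horb : ∀ (g : G) v, orb ((a g).app (op (SimplexCategory.mk 0)) v) = orb v :=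
    fun g v => Quotient.sound ⟨g, rfl⟩
  obtain ⟨γ, hγ⟩ := exists_equivariant_section (G := G) hfree
  let T := X.nonDegenerate (m + 1)
  have : Finite T := hfin
  have horb_inj : ∀ x ∈ X.nonDegenerate (m + 1),
      Function.Injective fun i => orb (simplexVertex x i) := by
    intro x hx i j hij
    obtain ⟨g, hg⟩ := MulAction.orbitRel_apply.1 (Quotient.exact hij)
    have hg1 : g = 1 := hdisj x hx g j i hg
    refine hinj x hx ?_
    rw [← hg, hg1]
    exact one_smul G _
  -- The configurations run over pairs of a simplex and a sign pattern, because the signs depend on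
  -- the vectors and are chosen afterwards. Signs are moved from the vectors into the argument of
  -- the Bernstein form.
  obtain ⟨w, hw⟩ := exists_generic_weights (V := V)
    (fun (j : T × (Fin (m + 2) → ℤˣ)) i => orb (simplexVertex j.1.1 i))
    (fun j => horb_inj j.1.1 j.1.2)
    (fun j i => representationEquiv ρ (γ (simplexVertex j.1.1 i)))
    (fun j y => bernsteinForm N (f.toFun (m + 1) j.1.1) fun i => ((j.2 i : ℤ) : ℝ) * y i) (N + 1)
    (fun j φ => (contDiff_bernsteinForm N (f.toFun (m + 1) j.1.1) φ).comp
      (contDiff_pi.2 fun i => contDiff_const.mul (contDiff_apply ℝ ℝ i)))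
    (fun j r y => by
      rw [← bernsteinForm_smul]
      congr 1
      funext i
      simp [mul_left_comm])
  let b (v : X.obj (op (SimplexCategory.mk 0))) : V := ρ (γ v) (w (orb v))
  have hb : ∀ x ∈ X.nonDegenerate (m + 1), ∀ y : Fin (m + 2) → ℝ, y ≠ 0 →
      {i | y i ≠ 0}.ncard ≤ Module.finrank ℝ V → ∑ i, y i • b (simplexVertex x i) ≠ 0 := by
    intro x hx y hy hc
    -- With the coefficient of the Bernstein form equal to `0`, genericity reduces to linear
    -- independence of few vectors.
    have h := hw (⟨x, hx⟩, 1) (fun k => k.elim 0 y) (Function.ne_iff.1 hy)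
      (by rwa [ncard_option_of_none _ rfl])
    simp only [Option.elim, zero_smul, zero_add] at h
    exact h
  let R := {ω : Ω // ∃ (t : T) (i : Fin (m + 2)), orb (simplexVertex t.1 i) = ω}
  have : Finite R := Set.Finite.to_subtype (s := {ω | ∃ (t : T) (i : Fin (m + 2)), _})
    ((Set.finite_range fun q : T × Fin (m + 2) => orb (simplexVertex q.1.1 q.2)).subset
      fun _ ⟨t, i, h⟩ => ⟨(t, i), h⟩)
  have := Fintype.ofFinite R
  let orbits := {O : Set (X.obj (op (SimplexCategory.mk (m + 1)))) |
    ∃ x ∈ X.nonDegenerate (m + 1),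
      O = Set.range fun g : G => (a g).app (op (SimplexCategory.mk (m + 1))) x}
  have hofin : orbits.Finite := Set.encard_lt_top_iff.1 (hlt.trans (by
    exact_mod_cast ENat.natCast_lt_top (2 ^ (m + 1))))
  have : Fintype orbits := hofin.fintype
  have hcard : Fintype.card orbits < 2 ^ (m + 1) := by
    have h : orbits.encard < 2 ^ (m + 1) := hlt
    rw [Set.encard_eq_coe_toFinset_card, Set.toFinset_card] at h
    exact_mod_cast h
  have hrep : ∀ O : orbits, ∃ x : T,
      O.1 = Set.range fun g : G => (a g).app (op (SimplexCategory.mk (m + 1))) x.1 := by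
    rintro ⟨O, x, hx, h⟩
    exact ⟨⟨x, hx⟩, h⟩
  choose rep hrep using hrep
  let vtx (t : T) (i : Fin (m + 2)) : R := ⟨orb (simplexVertex t.1 i), t, i, rfl⟩
  have hvtx : ∀ t, Function.Injective (vtx t) := fun t i j h =>
    horb_inj t.1 t.2 (congrArg Subtype.val h)
  obtain ⟨ε, hε⟩ := exists_signs (m + 1) hcard
    (fun O => {ε : R → ℤˣ | ∃ p : stdSimplex ℝ (Fin (m + 2)),
      ∑ i, (p i * ((ε (vtx (rep O) i) : ℤ) : ℝ)) • b (simplexVertex (rep O).1 i) = 0})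
    -- For a bad choice the sign at vertex `0` determines those at the remaining `m + 1` vertices.
    (fun O => Finset.univ.image fun i : Fin (m + 1) => vtx (rep O) i.succ)
    (fun O => (Finset.card_image_of_injective _ ((hvtx (rep O)).comp
      (Fin.succ_injective _))).trans (by simp))
    (by
      rintro O ε ⟨p, hp⟩ ε' ⟨p', hp'⟩ hee
      have h0 : ε (vtx (rep O) 0) = ε' (vtx (rep O) 0) := by
        refine hee _ fun h => ?_
        obtain ⟨i, -, hi⟩ := Finset.mem_image.1 h
        exact Fin.succ_ne_zero i (hvtx _ hi)
      have h1 := signs_eq_of_zero_mem_hull (fun i => b (simplexVertex (rep O).1 i))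
        (by rw [Fintype.card_fin, hn]) (hb _ (rep O).2) (ε := fun i => ε (vtx (rep O) i))
        (ε' := fun i => ε' (vtx (rep O) i)) p p' hp hp' 0 h0
      funext r
      by_cases hr : r ∈ Finset.univ.image fun i : Fin (m + 1) => vtx (rep O) i.succ
      · obtain ⟨i, -, rfl⟩ := Finset.mem_image.1 hr
        exact congrFun h1 i.succ
      · exact hee r hr)
  -- Orbits that meet no non-degenerate `(m+1)`-simplex are unconstrained and receive the sign `1`.
  let s (ω : Ω) : ℤˣ := if h : ∃ (t : T) (i : Fin (m + 2)), orb (simplexVertex t.1 i) = ω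
    then ε ⟨ω, h⟩ else 1
  have hs : ∀ (t : T) i, s (orb (simplexVertex t.1 i)) = ε (vtx t i) :=
    fun t i => dif_pos (vtx t i).2
  let φ (v : X.obj (op (SimplexCategory.mk 0))) : V := ((s (orb v) : ℤ) : ℝ) • b v
  have hφ : ∀ (g : G) v, φ ((a g).app (op (SimplexCategory.mk 0)) v) = ρ g (φ v) := by
    intro g v
    have hg : γ ((a g).app (op (SimplexCategory.mk 0)) v) = g * γ v := hγ g v
    simp only [φ, b, horb, hg, map_mul, map_smul, Module.End.mul_apply]
  refine ⟨affineSection φ hφ, fun x hx p h0 => ?_, fun x hx k hk θ hB p t ht h0 => ?_⟩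
  -- By equivariance a zero on `x` moves to a zero on the representative of its orbit, which the
  -- choice of signs excludes.
  · let O : orbits := ⟨_, x, hx, rfl⟩
    have hxO : x ∈ O.1 := ⟨1, by
      change (a 1).app _ x = x
      rw [map_one]
      rfl⟩
    rw [hrep O] at hxO
    obtain ⟨g, hg⟩ := hxO
    have hg' : (a g).app (op (SimplexCategory.mk (m + 1))) (rep O).1 = x := hg
    rw [← hg', SkeletalSection.equivariant] at h0
    have h1 : (affineSection φ hφ).toFun (m + 1) (rep O).1 p = 0 :=
      (representationEquiv ρ g).map_eq_zero_iff.1 h0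
    refine hε O ⟨p, ?_⟩
    rw [← h1]
    change _ = ∑ i, p i • φ (simplexVertex (rep O).1 i)
    refine Finset.sum_congr rfl fun i _ => ?_
    rw [mul_smul, ← hs]
  -- The end `t = 0` is the Bernstein section itself and is treated apart, since `t` is inverted
  -- below.
  · by_cases ht0 : t = 0
    · rw [ht0, sub_zero, one_smul, zero_smul, add_zero] at h0
      exact hB p h0
    set q := vertexMap θ.toOrderHom p with hq
    have e1 : (bernsteinSection f N).toFun k (X.map θ.op x) p =
        bernsteinForm N (f.toFun (m + 1) x) q := by
      rw [SkeletalSection.compat]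
      rfl
    have e2 : (affineSection φ hφ).toFun k (X.map θ.op x) p =
        ∑ i, q i • φ (simplexVertex x i) := by
      rw [SkeletalSection.compat]
      rfl
    rw [e1, e2] at h0
    let δ : Fin (m + 2) → ℤˣ := fun i => s (orb (simplexVertex x i))
    have hunit : ∀ e : ℤˣ, ((e : ℤ) : ℝ) * ((e : ℤ) : ℝ) = 1 := fun e => by
      rw [← Int.cast_mul, ← Units.val_mul, Int.units_mul_self, Units.val_one, Int.cast_one]
    have hunit0 : ∀ e : ℤˣ, ((e : ℤ) : ℝ) ≠ 0 := fun e => by exact_mod_cast e.ne_zero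
    -- Evaluated at `t • q`, the form of degree `N + 1` gains the factor `t ^ (N + 1)`, which the
    -- coefficient at `none` removes; what remains is the point of the line at time `t`.
    let z : Option (Fin (m + 2)) → ℝ := fun k =>
      k.elim ((1 - t) * (t ^ (N + 1))⁻¹) fun i => t * (((δ i : ℤ) : ℝ) * q i)
    refine hw (⟨x, hx⟩, δ) z ?_ ?_ ?_
    · obtain ⟨i, hi⟩ : ∃ i, q i ≠ 0 := by
        by_contra! hall
        have := stdSimplex.sum_eq_one q
        simp [hall] at this
      exact ⟨i, mul_ne_zero ht0 (mul_ne_zero (hunit0 _) hi)⟩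
    -- At most `k + 1` barycentric coordinates and one further coefficient are non-zero; since `k <
    -- m`, their number is at most `m + 1 = dim V`.
    · refine (ncard_option_le z).trans ?_
      have h1 : {i | z (some i) ≠ 0} ⊆ {i | q i ≠ 0} := by
        intro i hi hqi
        apply hi
        simp only [z, Option.elim, hqi, mul_zero]
      have h2 : {i | z (some i) ≠ 0}.ncard ≤ k + 1 := (Set.ncard_le_ncard h1 (Set.toFinite _)).trans
        (ncard_vertexMap_support_le θ.toOrderHom p)
      omega
    · have h1 : (fun i => ((δ i : ℤ) : ℝ) * z (some i)) = t • (q : Fin (m + 2) → ℝ) := by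
        funext i
        simp only [z, Option.elim, Pi.smul_apply, smul_eq_mul]
        rw [mul_left_comm, ← mul_assoc ((δ i : ℤ) : ℝ), hunit, one_mul]
      have h2 : ∀ i, z (some i) • representationEquiv ρ (γ (simplexVertex x i))
          (w (orb (simplexVertex x i))) = t • q i • φ (simplexVertex x i) := by
        intro i
        change (t * (((δ i : ℤ) : ℝ) * q i)) • b (simplexVertex x i) = _
        rw [smul_smul, smul_smul]
        congr 1
        ring
      simp only [h2]
      rw [h1, bernsteinForm_smul, ← Finset.smul_sum]
      simp only [z, Option.elim]
      rw [smul_smul, inv_mul_cancel_right₀ (pow_ne_zero _ ht0)]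
      exact h0

end Core

/-! ### Coboundaries from zero-free sections, and the bound for regular simplicial sets -/

section Vanishing

variable {G : Type w} [Group G]
  {V : Type v} [AddCommGroup V] [Module ℝ V] [TopologicalSpace V] [IsTopologicalAddGroup V]
  [ContinuousSMul ℝ V] [T2Space V] [FiniteDimensional ℝ V] {ρ : Representation ℝ G V}
  {X : SSet.{u}} {a : G →* End X}

/-- Non-vanishing is witnessed by an unspecified section, so every section has to be treated. -/
lemma not_eulerClassNonzero_of_forall_mem {n : ℕ}
    (h : ∀ f : SkeletalSection ρ a n,
      f.eulerCochain ∈ equivCoboundaries a (orientationModule ρ n) n) :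
    ¬ EulerClassNonzero ρ a n := by
  rintro ⟨_, ⟨f, rfl⟩, hne⟩
  exact hne ((Submodule.Quotient.mk_eq_zero _).2 (h f))

variable [Finite G]

lemma finite_nonDegenerate_of_orbits {n : ℕ}
    (h : {O : Set (X.obj (op (SimplexCategory.mk n))) | ∃ x ∈ X.nonDegenerate n,
      O = Set.range fun g : G => (a g).app (op (SimplexCategory.mk n)) x}.Finite) :
    (X.nonDegenerate n).Finite := by
  refine (h.sUnion ?_).subset fun x hx => Set.mem_sUnion.2 ⟨_, ⟨x, hx, rfl⟩, 1, ?_⟩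
  · rintro _ ⟨x, -, rfl⟩
    exact Set.finite_range _
  · change (a 1).app _ x = x
    rw [map_one]
    rfl

/-- The Euler class of a representation of dimension `n` vanishes on a free simplicial set with
fewer than `2 ^ n` orbits of non-degenerate `n`-simplices, if every such simplex has distinct
vertices, which lie in distinct orbits. -/
theorem eulerCocycle_mem_equivCoboundaries {n : ℕ} (hn : Module.finrank ℝ V = n)
    (hfree : ∀ (v : X.obj (op (SimplexCategory.mk 0))) (g : G),
      (a g).app (op (SimplexCategory.mk 0)) v = v → g = 1)
    (hinj : ∀ x ∈ X.nonDegenerate n, Function.Injective (simplexVertex x))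
    (hdisj : ∀ x ∈ X.nonDegenerate n, ∀ (g : G) (i j : Fin (n + 1)),
      (a g).app (op (SimplexCategory.mk 0)) (simplexVertex x i) = simplexVertex x j → g = 1)
    (hlt : {O : Set (X.obj (op (SimplexCategory.mk n))) | ∃ x ∈ X.nonDegenerate n,
      O = Set.range fun g : G => (a g).app (op (SimplexCategory.mk n)) x}.encard < 2 ^ n)
    (f : SkeletalSection ρ a n) :
    f.eulerCochain ∈ equivCoboundaries a (orientationModule ρ n) n := by
  have hfin : (X.nonDegenerate n).Finite := finite_nonDegenerate_of_orbits
    (Set.encard_lt_top_iff.1 (hlt.trans (by exact_mod_cast ENat.natCast_lt_top (2 ^ n))))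
  cases n with
  | zero =>
    refine (Submodule.mem_bot ℤ).2 (Subtype.ext (funext fun x => ?_))
    -- Fewer than one orbit means that there are no vertices at all.
    rw [pow_zero, Set.encard_lt_one] at hlt
    have hx : x ∈ X.nonDegenerate 0 := by simp
    exact absurd hlt (Set.Nonempty.ne_empty ⟨_, x, hx, rfl⟩)
  | succ m =>
    -- Only the faces of non-degenerate `n`-simplices matter. They are finite in number, so one
    -- degree `N` serves all of them, and their vertices are distinct, as `coboundary_degenerate`
    -- requires.
    let S : Set (X.obj (op (SimplexCategory.mk m))) :=
      {τ | ∃ x ∈ X.nonDegenerate (m + 1), ∃ i, X.δ i x = τ}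
    have hSfin : S.Finite := by
      refine ((hfin.prod (Set.finite_univ (α := Fin (m + 2)))).image
        fun q => X.δ q.2 q.1).subset ?_
      rintro _ ⟨x, hx, i, rfl⟩
      exact ⟨(x, i), ⟨hx, Set.mem_univ i⟩, rfl⟩
    have hSapp : ∀ g : G, ∀ τ ∈ S, (a g).app (op (SimplexCategory.mk m)) τ ∈ S := by
      rintro g _ ⟨x, hx, i, rfl⟩
      exact ⟨_, (app_mem_nonDegenerate_iff a g x).2 hx, i,
        (app_map a g (SimplexCategory.δ i) x).symm⟩
    have hS : ∀ (g : G) τ, (a g).app (op (SimplexCategory.mk m)) τ ∈ S ↔ τ ∈ S := by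
      refine fun g τ => ⟨fun h => ?_, hSapp g τ⟩
      have := hSapp g⁻¹ _ h
      rwa [app_inv_app] at this
    have hSinj : ∀ τ ∈ S, Function.Injective (simplexVertex τ) := by
      rintro _ ⟨x, hx, i, rfl⟩ k l hkl
      have hv : ∀ k, simplexVertex (X.δ i x) k = simplexVertex x (i.succAbove k) :=
        simplexVertex_map (SimplexCategory.δ i) x
      rw [hv, hv] at hkl
      exact Fin.succAbove_right_injective (hinj x hx hkl)
    have hN : ∀ᶠ N in Filter.atTop, ∀ τ ∈ S, LineNeZero f (bernsteinSection f N) τ := by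
      rw [Filter.eventually_all_finite hSfin]
      exact fun τ _ => eventually_line_bernsteinForm_ne_zero (f.toFun m τ)
        (f.ne_zero m (Nat.lt_succ_self m) τ)
    obtain ⟨N, hN⟩ := hN.exists
    obtain ⟨F, hF, hBF⟩ := exists_affineSection_ne_zero hn hfree hinj hdisj hfin hlt f N
    have hB : ∀ τ ∈ S, ∀ p, (bernsteinSection f N).toFun m τ p ≠ 0 := fun τ hτ => (hN τ hτ).right
    have hFS : ∀ τ ∈ S, ∀ p, F.toFun m τ p ≠ 0 := by
      rintro _ ⟨x, hx, i, rfl⟩ p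
      rw [F.toFun_δ]
      exact hF x hx _
    obtain ⟨c₁, hc₁, hd₁⟩ := exists_difference_cochain f.forget (bernsteinSection f N) S hS
      (fun τ _ => f.ne_zero m (Nat.lt_succ_self m) τ) hB (by
        rintro τ hτ k rfl i
        exact (hN τ hτ).map (SimplexCategory.δ i))
    obtain ⟨c₂, hc₂, hd₂⟩ := exists_difference_cochain (bernsteinSection f N) F S hS hB hFS (by
        rintro _ ⟨x, hx, i, rfl⟩ k rfl j
        have h := hBF x hx k (Nat.lt_succ_self k) (SimplexCategory.δ j ≫ SimplexCategory.δ i)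
        rw [op_comp, X.map_comp] at h
        refine h fun p => ?_
        have hδ : (bernsteinSection f N).toFun k
            ((X.map (SimplexCategory.δ i).op ≫ X.map (SimplexCategory.δ j).op) x) =
            ((bernsteinSection f N).toFun (k + 1) (X.δ i x)).comp (simplexMap j.succAbove) :=
          (bernsteinSection f N).toFun_δ (X.δ i x) j
        rw [hδ]
        exact hB _ ⟨x, hx, i, rfl⟩ _)
    -- On non-degenerate simplices the two coboundaries are `[B] - [f]` and `[F] - [B]`, where `[F]
    -- = 0`; their sum is `-[f]`.
    refine LinearMap.mem_range.2 ⟨-(c₁ + c₂), Subtype.ext (funext fun σ => ?_)⟩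
    have he : f.eulerCochain.1 σ =
        relClass ({0}ᶜ : Set V) (m + 1) (Finsupp.single (f.toFun (m + 1) σ) 1) :=
      (relClass_of_mem _).symm
    rw [he]
    by_cases hσ : σ ∈ X.nonDegenerate (m + 1)
    · have h₁ := hd₁ σ fun i => ⟨σ, hσ, i, rfl⟩
      have h₂ := hd₂ σ fun i => ⟨σ, hσ, i, rfl⟩
      have hz : Finsupp.single (F.toFun (m + 1) σ) (1 : ℤ) ∈ chainsIn ({0}ᶜ : Set V) (m + 1) :=
        Finsupp.single_mem_supported ℤ _ (hF σ hσ)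
      rw [relClass_eq_zero_of_chainsIn hz] at h₂
      rw [map_neg, map_add]
      change -((coboundary a (orientationModule ρ (m + 1)) m c₁).1 σ +
        (coboundary a (orientationModule ρ (m + 1)) m c₂).1 σ) = _
      rw [h₁, h₂]
      change -(_ - relClass ({0}ᶜ : Set V) (m + 1) (Finsupp.single (f.toFun (m + 1) σ) 1) + _) = _
      abel
    · rw [← SSet.mem_degenerate_iff_notMem_nonDegenerate, SSet.degenerate_eq_iUnion_range_σ] at hσ
      obtain ⟨j, y, rfl⟩ := Set.mem_iUnion.1 hσ
      -- On a degenerate simplex both sides vanish: `f` factors there through a simplex of lower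
      -- dimension, where it has no zeros.
      rw [coboundary_degenerate]
      · refine (relClass_eq_zero_of_chainsIn (Finsupp.single_mem_supported ℤ _ fun p => ?_)).symm
        have hσ : f.toFun (m + 1) (X.σ j y) = (f.toFun m y).comp (simplexMap _) :=
          f.compat (SimplexCategory.σ j) y
        rw [hσ]
        exact f.ne_zero m (Nat.lt_succ_self m) y _
      · intro τ hτ
        have hτS : τ ∉ S := fun h => hτ (hSinj τ h)
        change -(c₁.1 τ + c₂.1 τ) = 0
        rw [hc₁ τ hτS, hc₂ τ hτS, add_zero, neg_zero]

/-- The lower bound for regular simplicial sets. -/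
theorem two_pow_le_encard_of_nonsingular {n : ℕ} (hn : Module.finrank ℝ V = n) [X.Nonsingular]
    (hX : ∀ (k : ℕ), ∀ x ∈ X.nonDegenerate k, ∀ g : G, g ≠ 1 →
      SSet.Subcomplex.ofSimplex x ⊓
        SSet.Subcomplex.ofSimplex ((a g).app (op (SimplexCategory.mk k)) x) = ⊥)
    (he : EulerClassNonzero ρ a n) :
    (2 ^ n : ℕ∞) ≤ {O : Set (X.obj (op (SimplexCategory.mk n))) | ∃ x ∈ X.nonDegenerate n,
      O = Set.range fun g : G => (a g).app (op (SimplexCategory.mk n)) x}.encard := by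
  by_contra! hlt
  have hdisj : ∀ k, ∀ x ∈ X.nonDegenerate k, ∀ (g : G) (i j : Fin (k + 1)),
      (a g).app (op (SimplexCategory.mk 0)) (simplexVertex x i) = simplexVertex x j → g = 1 := by
    intro k x hx g i j h
    by_contra hg
    have hmem : simplexVertex x j ∈ (SSet.Subcomplex.ofSimplex x ⊓ SSet.Subcomplex.ofSimplex
        ((a g).app (op (SimplexCategory.mk k)) x)).obj (op (SimplexCategory.mk 0)) := by
      refine ⟨(SSet.Subcomplex.ofSimplex x).map _ (SSet.Subcomplex.mem_ofSimplex_obj x), ?_⟩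
      rw [← h, ← simplexVertex_app]
      exact (SSet.Subcomplex.ofSimplex _).map _ (SSet.Subcomplex.mem_ofSimplex_obj _)
    rw [hX k x hx g hg] at hmem
    exact hmem
  refine not_eulerClassNonzero_of_forall_mem
    (fun f => eulerCocycle_mem_equivCoboundaries hn ?_ ?_ (hdisj n) hlt f) he
  · intro v g hv
    refine hdisj 0 v (by simp) g 0 0 ?_
    rw [← simplexVertex_app, hv]
  · intro x hx i j hij
    -- The characteristic map of `x` is injective, so equal vertices come from equal maps of `[0]`
    -- into `[n]`.
    have := SSet.Nonsingular.injective_map x hx hij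
    have h0 := congrArg (fun θ : SimplexCategory.mk 0 ⟶ SimplexCategory.mk n =>
      θ.toOrderHom 0) this
    exact h0

end Vanishing

/-! ### Sorting ordered chains -/

section Sorting

variable {ι : Type*} {Ω : Type*} [LinearOrder Ω] (π : ι → Ω)

/-- An index at which a tuple is minimal. -/
def argminIndex {k : ℕ} (s : Fin (k + 1) → Ω) : Fin (k + 1) := (Finite.exists_min s).choose

lemma argminIndex_le {k : ℕ} (s : Fin (k + 1) → Ω) (j : Fin (k + 1)) : s (argminIndex s) ≤ s j :=
  (Finite.exists_min s).choose_spec j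

/-- The chain map from ordered chains to chains of tuples that are monotone for `π`. -/
def ordSort : ∀ k, OrdChain ι k →ₗ[ℤ] OrdChain ι k
  | 0 => LinearMap.id
  | k + 1 => Finsupp.linearCombination ℤ fun t : Fin (k + 2) → ι =>
      ordCone (t (argminIndex (π ∘ t))) k (ordSort k (ordBoundary ι k (Finsupp.single t 1)))

lemma ordSort_succ_single (k : ℕ) (t : Fin (k + 2) → ι) :
    ordSort π (k + 1) (Finsupp.single t 1) = ordCone (t (argminIndex (π ∘ t))) k
      (ordSort π k (ordBoundary ι k (Finsupp.single t 1))) := by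
  rw [ordSort, Finsupp.linearCombination_single, one_smul]

lemma ordBoundary_ordSort (k : ℕ) (c : OrdChain ι (k + 1)) :
    ordBoundary ι k (ordSort π (k + 1) c) = ordSort π k (ordBoundary ι k c) := by
  induction k with
  | zero =>
    refine linearMap_eq_of_single (f := ordBoundary ι 0 ∘ₗ ordSort π 1)
      (g := ordSort π 0 ∘ₗ ordBoundary ι 0) (fun t => ?_) c
    rw [LinearMap.comp_apply, LinearMap.comp_apply, ordSort_succ_single, ordBoundary_ordCone_zero]
    simp only [ordSort, LinearMap.id_apply, ordAug_ordBoundary, zero_smul, sub_zero]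
  | succ k ih =>
    refine linearMap_eq_of_single (f := ordBoundary ι (k + 1) ∘ₗ ordSort π (k + 2))
      (g := ordSort π (k + 1) ∘ₗ ordBoundary ι (k + 1)) (fun t => ?_) c
    rw [LinearMap.comp_apply, LinearMap.comp_apply, ordSort_succ_single, ordBoundary_ordCone_succ,
      ih, ordBoundary_ordBoundary, map_zero, map_zero, sub_zero]

/-- The index of the apex is selected from `π ∘ t` alone, so it is unchanged by a map of vertices
that preserves `π`. -/
lemma ordMap_ordSort (φ : ι → ι) (hφ : ∀ v, π (φ v) = π v) (k : ℕ) (c : OrdChain ι k) :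
    ordMap φ k (ordSort π k c) = ordSort π k (ordMap φ k c) := by
  induction k with
  | zero => rfl
  | succ k ih =>
    refine linearMap_eq_of_single (f := ordMap φ (k + 1) ∘ₗ ordSort π (k + 1))
      (g := ordSort π (k + 1) ∘ₗ ordMap φ (k + 1)) (fun t => ?_) c
    have h : π ∘ φ ∘ t = π ∘ t := funext fun i => hφ (t i)
    rw [LinearMap.comp_apply, LinearMap.comp_apply, ordMap_single, ordSort_succ_single,
      ordSort_succ_single, ordMap_ordCone, ih, ordMap_ordBoundary, ordMap_single, h]
    rfl

/-- By induction the sorted faces are monotone with vertices among those of `t`, and prepending a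
vertex of `t` with minimal `π` keeps them monotone. -/
lemma ordSort_mem_supported_monotone (k : ℕ) (t : Fin (k + 1) → ι) :
    ordSort π k (Finsupp.single t 1) ∈
      Finsupp.supported ℤ ℤ {s : Fin (k + 1) → ι | (∀ i, s i ∈ Set.range t) ∧ Monotone (π ∘ s)} := by
  induction k with
  | zero =>
    exact Finsupp.single_mem_supported ℤ _
      ⟨fun i => ⟨i, rfl⟩, fun i j _ => by
        have : i = j := Subsingleton.elim (α := Fin 1) i j
        rw [this]⟩
  | succ k ih =>
    rw [ordSort_succ_single]
    refine ordCone_mem_supported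
      (A := {s : Fin (k + 1) → ι | (∀ i, s i ∈ Set.range t) ∧ Monotone (π ∘ s)}) ?_ ?_
    · rintro s ⟨hs, hmono⟩
      refine ⟨cons_mem (Set.mem_range_self _) hs, ?_⟩
      rw [Fin.monotone_iff_le_succ]
      intro i
      refine Fin.cases ?_ (fun j => ?_) i
      · obtain ⟨j, hj⟩ := hs 0
        simp only [Function.comp_apply, Fin.castSucc_zero, Fin.cons_zero, Fin.cons_succ]
        rw [← hj]
        exact argminIndex_le (π ∘ t) j
      · simp only [Function.comp_apply, ← Fin.succ_castSucc, Fin.cons_succ]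
        exact hmono (Fin.castSucc_le_succ j)
    · rw [ordBoundary_single, map_sum]
      refine Submodule.sum_mem _ fun i _ => ?_
      rw [map_zsmul]
      refine Submodule.smul_mem _ _ (Finsupp.supported_mono ?_ (ih _))
      exact fun s hs => ⟨fun j => Set.range_comp_subset_range _ _ (hs.1 j), hs.2⟩

/-- The chain homotopy between the identity and sorting. -/
def sortHomotopy (k : ℕ) : OrdChain ι k →ₗ[ℤ] OrdChain ι (k + 1) :=
  ordFill (fun k => LinearMap.id - ordSort π k) (fun _ t => t 0) k

lemma ordBoundary_sortHomotopy (k : ℕ) (c : OrdChain ι (k + 1)) :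
    sortHomotopy π k (ordBoundary ι k c) =
      c - ordSort π (k + 1) c - ordBoundary ι (k + 1) (sortHomotopy π (k + 1) c) := by
  rw [sortHomotopy, sortHomotopy, ordBoundary_ordFill_succ]
  · simp
  · intro c
    simp [ordSort]
  · intro k c
    simp [ordBoundary_ordSort]

lemma ordMap_sortHomotopy (φ : ι → ι) (hφ : ∀ v, π (φ v) = π v) (k : ℕ) (c : OrdChain ι k) :
    ordMap φ (k + 1) (sortHomotopy π k c) = sortHomotopy π k (ordMap φ k c) :=
  ordMap_ordFill φ φ (fun k c => by simp [ordMap_ordSort π φ hφ]) (fun _ _ => rfl) k c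

lemma sortHomotopy_mem (k : ℕ) (t : Fin (k + 1) → ι) :
    sortHomotopy π k (Finsupp.single t 1) ∈ ordSupported (Set.range t) (k + 1) :=
  ordFill_mem (fun k t => sub_mem (Finsupp.single_mem_supported ℤ _ fun i => ⟨i, rfl⟩)
    (Finsupp.supported_mono (fun _ hs => hs.1) (ordSort_mem_supported_monotone π k t)))
    (fun _ _ => ⟨0, rfl⟩) k t

/-- Linear maps agreeing on the generators in `A` agree on chains supported in `A`. -/
lemma linearMap_eq_of_mem_supported {S M : Type*} [AddCommGroup M] {A : Set S}
    {f g : (S →₀ ℤ) →ₗ[ℤ] M}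
    (h : ∀ s ∈ A, f (Finsupp.single s 1) = g (Finsupp.single s 1)) {c : S →₀ ℤ}
    (hc : c ∈ Finsupp.supported ℤ ℤ A) : f c = g c := by
  rw [Finsupp.supported_eq_span_single] at hc
  refine LinearMap.eqOn_span (f := f) (g := g) ?_ hc
  rintro _ ⟨s, hs, rfl⟩
  exact h s hs

end Sorting

/-! ### Equivariant cochains as linear forms on all ordered chains -/

section Extension

variable {ι : Type*} {G A : Type*} [Group G] [MulAction G ι] [AddCommGroup A]
  {α : Representation ℤ G A}

open Classical in
/-- Linear extension, by zero, of a function on the tuples with property `P`. -/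
def extendCochain {k : ℕ} {P : (Fin (k + 1) → ι) → Prop} (c : {t // P t} → A) :
    OrdChain ι k →ₗ[ℤ] A :=
  Finsupp.linearCombination ℤ fun t => if h : P t then c ⟨t, h⟩ else 0


lemma extendCochain_single {k : ℕ} {P : (Fin (k + 1) → ι) → Prop} (c : {t // P t} → A)
    {t : Fin (k + 1) → ι} (h : P t) : extendCochain c (Finsupp.single t 1) = c ⟨t, h⟩ := by
  rw [extendCochain, Finsupp.linearCombination_single, one_smul, dif_pos h]

lemma extendCochain_ordMap {k : ℕ} {P : (Fin (k + 1) → ι) → Prop} (c : {t // P t} → A) (g : G)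
    (hP : ∀ t, P ((g • ·) ∘ t) ↔ P t)
    (hc : ∀ t (h : P t), c ⟨(g • ·) ∘ t, (hP t).2 h⟩ = α g (c ⟨t, h⟩)) (z : OrdChain ι k) :
    extendCochain c (ordMap (g • ·) k z) = α g (extendCochain c z) := by
  refine linearMap_eq_of_single (f := extendCochain c ∘ₗ ordMap (g • ·) k)
    (g := α g ∘ₗ extendCochain c) (fun t => ?_) z
  rw [LinearMap.comp_apply, LinearMap.comp_apply, ordMap_single]
  by_cases h : P t
  · rw [extendCochain_single c h, extendCochain_single c ((hP t).2 h), hc]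
  · rw [extendCochain, Finsupp.linearCombination_single, Finsupp.linearCombination_single,
      dif_neg h, dif_neg fun h' => h ((hP t).1 h'), smul_zero, map_zero]

lemma monotone_smul_iff {Ω : Type*} [LinearOrder Ω] (π : ι → Ω)
    (hπ : ∀ (g : G) v, π (g • v) = π v) (g : G) {k : ℕ} (t : Fin (k + 1) → ι) :
    Monotone (π ∘ (g • ·) ∘ t) ↔ Monotone (π ∘ t) := by
  have h : π ∘ (g • ·) ∘ t = π ∘ t := funext fun i => hπ g (t i)
  rw [h]

end Extension

/-! ### The simplicial set of monotone simplices of a simplicial complex -/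

section MonotoneSimplices

variable {ι : Type u} [DecidableEq ι] (K : AbstractSimplicialComplex ι)

lemma image_mem_of_forall_mem_range {k l : ℕ} {t : Fin (k + 1) → ι}
    (ht : Finset.univ.image t ∈ K) {s : Fin (l + 1) → ι} (hs : ∀ i, s i ∈ Set.range t) :
    Finset.univ.image s ∈ K := by
  refine (K.isRelLowerSet_faces ht).2 ?_ (Finset.univ_nonempty.image _)
  intro v hv
  obtain ⟨i, -, rfl⟩ := Finset.mem_image.1 hv
  obtain ⟨j, hj⟩ := hs i
  exact Finset.mem_image.2 ⟨j, Finset.mem_univ j, hj⟩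

variable {Ω : Type u} [LinearOrder Ω] (π : ι → Ω)

/-- The simplicial set of tuples that span a face of `K` and are monotone for `π`. -/
def monotoneSSet : SSet.{u} where
  obj m := {t : Fin (m.unop.len + 1) → ι // Finset.univ.image t ∈ K ∧ Monotone (π ∘ t)}
  map θ := TypeCat.ofHom fun t => ⟨t.1 ∘ θ.unop.toOrderHom,
    image_mem_of_forall_mem_range K t.2.1 fun i => ⟨θ.unop.toOrderHom i, rfl⟩,
    t.2.2.comp θ.unop.toOrderHom.monotone⟩

variable {G : Type w} [Group G] [MulAction G ι] (hK : ∀ (g : G), ∀ s ∈ K, g • s ∈ K)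
  (hπ : ∀ (g : G) v, π (g • v) = π v)

/-- The action on monotone simplices induced by a simplicial action preserving `π`. -/
def monotoneAction : G →* End (monotoneSSet K π) where
  toFun g :=
    { app := fun m => TypeCat.ofHom fun t => ⟨fun i => g • t.1 i, by
        have h := hK g _ t.2.1
        rwa [Finset.smul_finset_def, Finset.image_image] at h,
        fun i j hij => by
          simp only [Function.comp_apply, hπ]
          exact t.2.2 hij⟩ }
  map_one' := by
    refine NatTrans.ext (funext fun m => ConcreteCategory.hom_ext _ _ fun t => ?_)
    exact Subtype.ext (funext fun i => one_smul G _)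
  map_mul' g h := by
    refine NatTrans.ext (funext fun m => ConcreteCategory.hom_ext _ _ fun t => ?_)
    exact Subtype.ext (funext fun i => mul_smul g h _)

section Restriction

variable {V : Type v} [AddCommGroup V] [Module ℝ V] [TopologicalSpace V] [IsTopologicalAddGroup V]
  [ContinuousSMul ℝ V] [T2Space V] [FiniteDimensional ℝ V] {ρ : Representation ℝ G V}

/-- Restriction of an equivariant map to the monotone simplices. -/
def SkeletalSection.restrictMonotone {n : ℕ} (f : SkeletalSection ρ (orderedAction K hK) n) :
    SkeletalSection ρ (monotoneAction K π hK hπ) n where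
  toFun k x := f.toFun k ⟨x.1, x.2.1⟩
  compat θ x := f.compat θ ⟨x.1, x.2.1⟩
  equivariant g k x := f.equivariant g k ⟨x.1, x.2.1⟩
  ne_zero k hk x := f.ne_zero k hk ⟨x.1, x.2.1⟩

end Restriction

variable {A : Type v} [AddCommGroup A] {α : Representation ℤ G A}

/-- Restriction of an equivariant cochain to the monotone simplices. -/
def restrictMonotone {n : ℕ} (e : equivCochains (orderedAction K hK) α n) :
    equivCochains (monotoneAction K π hK hπ) α n :=
  ⟨fun x => e.1 ⟨x.1, x.2.1⟩, fun g x => e.2 g ⟨x.1, x.2.1⟩⟩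

lemma image_smul_mem_iff (hK : ∀ (g : G), ∀ s ∈ K, g • s ∈ K) (g : G) {k : ℕ} (t : Fin (k + 1) → ι) :
    Finset.univ.image ((g • ·) ∘ t) ∈ K ↔ Finset.univ.image t ∈ K := by
  have h : ∀ (g : G) (t : Fin (k + 1) → ι), Finset.univ.image t ∈ K →
      Finset.univ.image ((g • ·) ∘ t) ∈ K := by
    intro g t ht
    have h := hK g _ ht
    rwa [Finset.smul_finset_def, Finset.image_image] at h
  refine ⟨fun ht => ?_, h g t⟩
  have h1 := h g⁻¹ _ ht
  have h2 : ((g⁻¹ • ·) : ι → ι) ∘ (g • ·) ∘ t = t := funext fun i => inv_smul_smul g (t i)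
  rwa [h2] at h1

/-- An equivariant cocycle on the ordered simplices that is a coboundary on the monotone simplices
is a coboundary. -/
theorem mem_equivCoboundaries_of_restrictMonotone {n : ℕ}
    (e : equivCochains (orderedAction K hK) α n)
    (he : e ∈ equivCocycles (orderedAction K hK) α n)
    (hr : restrictMonotone K π hK hπ e ∈ equivCoboundaries (monotoneAction K π hK hπ) α n) :
    e ∈ equivCoboundaries (orderedAction K hK) α n := by
  cases n with
  | zero =>
    refine (Submodule.mem_bot ℤ).2 (Subtype.ext (funext fun x => ?_))
    have h := congrFun (congrArg Subtype.val ((Submodule.mem_bot ℤ).1 hr))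
      ⟨x.1, x.2, fun i j _ => by
        have : i = j := Subsingleton.elim (α := Fin 1) i j
        rw [this]⟩
    exact h
  | succ m =>
    obtain ⟨c, hc⟩ := LinearMap.mem_range.1 hr
    -- Extension by zero lets the sorting operators act on all ordered chains; the cocycle relations
    -- are used only on chains supported in `K`.
    let c' : OrdChain ι m →ₗ[ℤ] A := extendCochain (A := A)
      (P := fun t : Fin (m + 1) → ι => Finset.univ.image t ∈ K ∧ Monotone (π ∘ t)) c.1
    let e' : OrdChain ι (m + 1) →ₗ[ℤ] A := extendCochain (A := A)
      (P := fun t : Fin (m + 2) → ι => Finset.univ.image t ∈ K) e.1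
    have hc'g : ∀ (g : G) z, c' (ordMap (g • ·) m z) = α g (c' z) := fun g =>
      extendCochain_ordMap c.1 g
        (fun t => and_congr (image_smul_mem_iff K hK g t) (monotone_smul_iff π hπ g t))
        (fun t h => c.2 g ⟨t, h⟩)
    have he'g : ∀ (g : G) z, e' (ordMap (g • ·) (m + 1) z) = α g (e' z) := fun g =>
      extendCochain_ordMap e.1 g (fun t => image_smul_mem_iff K hK g t) (fun t h => e.2 g ⟨t, h⟩)
    have hce : ∀ z ∈ Finsupp.supported ℤ ℤ {s : Fin (m + 2) → ι |
        Finset.univ.image s ∈ K ∧ Monotone (π ∘ s)}, c' (ordBoundary ι m z) = e' z := by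
      intro z hz
      refine linearMap_eq_of_mem_supported (f := c' ∘ₗ ordBoundary ι m) (g := e')
        (fun s hs => ?_) hz
      have h := congrFun (congrArg Subtype.val hc) ⟨s, hs⟩
      rw [LinearMap.comp_apply, ordBoundary_single, map_sum]
      refine Eq.trans ?_ (h.trans (extendCochain_single e.1 hs.1).symm)
      refine Finset.sum_congr rfl fun i _ => ?_
      rw [map_zsmul]
      congr 1
      exact extendCochain_single c.1 ((monotoneSSet K π).δ i ⟨s, hs⟩).2
    have hee : ∀ z ∈ Finsupp.supported ℤ ℤ {s : Fin (m + 3) → ι | Finset.univ.image s ∈ K},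
        e' (ordBoundary ι (m + 1) z) = 0 := by
      intro z hz
      refine linearMap_eq_of_mem_supported (f := e' ∘ₗ ordBoundary ι (m + 1)) (g := 0)
        (fun s hs => ?_) hz
      have h := congrFun (congrArg Subtype.val (LinearMap.mem_ker.1 he)) ⟨s, hs⟩
      rw [LinearMap.comp_apply, ordBoundary_single, map_sum]
      refine Eq.trans ?_ h
      refine Finset.sum_congr rfl fun i _ => ?_
      rw [map_zsmul]
      congr 1
      exact extendCochain_single e.1 ((orderedSSet K).δ i ⟨s, hs⟩).2
    -- With sorting `s` and homotopy `h`, so that `h ∂ = 1 - s - ∂ h`, the coboundary of `d` is `c'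
    -- ∂ s + e' (1 - s - ∂ h)`. Here `c' ∂ s = e' s` because sorted chains are monotone, and `e' ∂ h
    -- = 0` because `e` is a cocycle; only `e'` is left.
    let d : OrdChain ι m →ₗ[ℤ] A := c' ∘ₗ ordSort π m + e' ∘ₗ sortHomotopy π m
    refine LinearMap.mem_range.2 ⟨⟨fun t => d (Finsupp.single t.1 1), fun g t => ?_⟩,
      Subtype.ext (funext fun t => ?_)⟩
    · suffices h : ∀ s : Fin (m + 1) → ι,
          d (Finsupp.single ((g • ·) ∘ s) 1) = α g (d (Finsupp.single s 1)) from h t.1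
      intro s
      rw [← ordMap_single]
      simp only [d, LinearMap.add_apply, LinearMap.comp_apply, map_add]
      rw [← ordMap_ordSort π _ (hπ g), ← ordMap_sortHomotopy π _ (hπ g), hc'g, he'g]
    · have h : ∑ i : Fin (m + 2), ((-1 : ℤ) ^ (i : ℕ)) •
          d (Finsupp.single ((orderedSSet K).δ i t).1 1) =
          d (ordBoundary ι m (Finsupp.single t.1 1)) := by
        rw [ordBoundary_single, map_sum]
        refine Finset.sum_congr rfl fun i _ => ?_
        rw [map_zsmul]
        rfl
      have hsub : {s : Fin (m + 2) → ι | (∀ i, s i ∈ Set.range t.1) ∧ Monotone (π ∘ s)} ⊆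
          {s : Fin (m + 2) → ι | Finset.univ.image s ∈ K ∧ Monotone (π ∘ s)} :=
        fun s hs => ⟨image_mem_of_forall_mem_range K t.2 hs.1, hs.2⟩
      have hsort := Finsupp.supported_mono (R := ℤ) (M := ℤ) hsub
        (ordSort_mem_supported_monotone π (m + 1) t.1)
      refine h.trans ?_
      simp only [d, LinearMap.add_apply, LinearMap.comp_apply]
      rw [← ordBoundary_ordSort, ordBoundary_sortHomotopy, map_sub, map_sub, hce, hee,
        sub_zero, add_sub_cancel]
      · exact extendCochain_single e.1 t.2
      · exact Finsupp.supported_mono (fun s hs => image_mem_of_forall_mem_range K t.2 hs)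
          (sortHomotopy_mem π (m + 1) t.1)
      · exact hsort

end MonotoneSimplices

/-! ### The lower bounds -/

section LowerBound

variable {ι : Type u} [DecidableEq ι] {K : AbstractSimplicialComplex ι}
  {G : Type w} [Group G] [MulAction G ι] {hK : ∀ (g : G), ∀ s ∈ K, g • s ∈ K}
  {Ω : Type u} [LinearOrder Ω] {π : ι → Ω} {hπ : ∀ (g : G) v, π (g • v) = π v}

lemma eq_one_of_smul_mem_face (hdis : ∀ s ∈ K, ∀ g : G, g ≠ 1 → Disjoint s (g • s))
    {s : Finset ι} (hs : s ∈ K) {v v' : ι} (hv : v ∈ s) (hv' : v' ∈ s) {g : G} (h : g • v = v') :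
    g = 1 := by
  by_contra hg
  exact Finset.disjoint_left.1 (hdis s hs g hg) hv' (h ▸ Finset.smul_mem_smul_finset hv)

/-- Two vertices with equal `π` are translates of each other, and no non-trivial element moves a
vertex of a face to a vertex of the same face. -/
lemma injOn_face {Ω : Type*} {π : ι → Ω}
    (hdis : ∀ s ∈ K, ∀ g : G, g ≠ 1 → Disjoint s (g • s))
    (hπ' : ∀ v v', π v = π v' → ∃ g : G, g • v = v') {s : Finset ι} (hs : s ∈ K) {v v' : ι}
    (hv : v ∈ s) (hv' : v' ∈ s) (h : π v = π v') : v = v' := by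
  obtain ⟨g, hg⟩ := hπ' v v' h
  rw [← hg, eq_one_of_smul_mem_face hdis hs hv hv' hg, one_smul]

lemma injective_of_mem_nonDegenerate_monotoneSSet
    (hdis : ∀ s ∈ K, ∀ g : G, g ≠ 1 → Disjoint s (g • s))
    (hπ' : ∀ v v', π v = π v' → ∃ g : G, g • v = v') {n : ℕ}
    {x : (monotoneSSet K π).obj (op (SimplexCategory.mk n))}
    (hx : x ∈ (monotoneSSet K π).nonDegenerate n) :
    Function.Injective (x.1 : Fin (n + 1) → ι) := by
  have hmem : ∀ i : Fin (n + 1), x.1 i ∈ Finset.univ.image x.1 :=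
    fun i => Finset.mem_image_of_mem _ (Finset.mem_univ i)
  have hmono : Monotone fun i : Fin (n + 1) => π (x.1 i) := x.2.2
  cases n with
  | zero =>
    intro i j _
    exact Subsingleton.elim (α := Fin 1) i j
  | succ m =>
    suffices h : StrictMono fun i : Fin (m + 2) => π (x.1 i) from
      fun i j hij => h.injective (congrArg π hij)
    rw [Fin.strictMono_iff_lt_succ]
    intro i
    refine lt_of_le_of_ne (hmono (Fin.castSucc_le_succ i)) fun heq => hx ?_
    have heq' : x.1 i.castSucc = x.1 i.succ :=
      injOn_face hdis hπ' x.2.1 (hmem _) (hmem _) heq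
    rw [SSet.degenerate_eq_iUnion_range_σ]
    -- If the entries `i` and `i + 1` coincide, deleting the latter and repeating the former
    -- recovers `x`.
    refine Set.mem_iUnion.2 ⟨i, (monotoneSSet K π).δ i.succ x, Subtype.ext (funext fun k => ?_)⟩
    change x.1 (i.succ.succAbove (i.predAbove k)) = x.1 k
    by_cases hk : k = i.succ
    · subst hk
      rw [Fin.predAbove_succ_self, Fin.succAbove_of_castSucc_lt _ _ Fin.castSucc_lt_succ, heq']
    · rw [Fin.succ_succAbove_predAbove hk]

lemma strictMono_of_mem_nonDegenerate_monotoneSSet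
    (hdis : ∀ s ∈ K, ∀ g : G, g ≠ 1 → Disjoint s (g • s))
    (hπ' : ∀ v v', π v = π v' → ∃ g : G, g • v = v') {n : ℕ}
    {x : (monotoneSSet K π).obj (op (SimplexCategory.mk n))}
    (hx : x ∈ (monotoneSSet K π).nonDegenerate n) :
    StrictMono fun i : Fin (n + 1) => π (x.1 i) := by
  have hmono : Monotone fun i : Fin (n + 1) => π (x.1 i) := x.2.2
  refine hmono.strictMono_of_injective fun i j hij => ?_
  exact injective_of_mem_nonDegenerate_monotoneSSet hdis hπ' hx
    (injOn_face hdis hπ' x.2.1 (Finset.mem_image_of_mem _ (Finset.mem_univ i))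
      (Finset.mem_image_of_mem _ (Finset.mem_univ j)) hij)

lemma image_monotoneAction (g : G) {n : ℕ}
    (x : (monotoneSSet K π).obj (op (SimplexCategory.mk n))) :
    Finset.univ.image ((monotoneAction K π hK hπ g).app (op (SimplexCategory.mk n)) x).1 =
      g • Finset.univ.image x.1 := by
  rw [Finset.smul_finset_def, Finset.image_image]
  rfl

/-- Passing to vertex sets is injective on orbits: a non-degenerate monotone tuple is strictly
increasing for `π`, and `π` is injective on each face, so the tuple is determined by its set of
vertices. -/
lemma encard_orbits_monotoneSSet_le (hdis : ∀ s ∈ K, ∀ g : G, g ≠ 1 → Disjoint s (g • s))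
    (hπ' : ∀ v v', π v = π v' → ∃ g : G, g • v = v') (n : ℕ) :
    {O : Set ((monotoneSSet K π).obj (op (SimplexCategory.mk n))) |
      ∃ x ∈ (monotoneSSet K π).nonDegenerate n, O = Set.range fun g : G =>
        (monotoneAction K π hK hπ g).app (op (SimplexCategory.mk n)) x}.encard ≤
      {O : Set (Finset ι) | ∃ s ∈ K, s.card = n + 1 ∧ O = MulAction.orbit G s}.encard := by
  have himage : ∀ x : (monotoneSSet K π).obj (op (SimplexCategory.mk n)),
      (fun y : (monotoneSSet K π).obj (op (SimplexCategory.mk n)) => Finset.univ.image y.1) ''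
        (Set.range fun g : G => (monotoneAction K π hK hπ g).app (op (SimplexCategory.mk n)) x) =
      MulAction.orbit G (Finset.univ.image x.1) := by
    intro x
    rw [← Set.range_comp]
    exact congrArg Set.range (funext fun g => image_monotoneAction g x)
  refine Set.encard_le_encard_of_injOn
    (f := fun O => (fun y : (monotoneSSet K π).obj (op (SimplexCategory.mk n)) =>
      Finset.univ.image y.1) '' O) ?_ ?_
  · rintro _ ⟨x, hx, rfl⟩
    refine ⟨Finset.univ.image x.1, x.2.1, ?_, himage x⟩
    exact (Finset.card_image_of_injective _
      (injective_of_mem_nonDegenerate_monotoneSSet hdis hπ' hx)).trans (by simp)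
  · rintro _ ⟨x, hx, rfl⟩ _ ⟨x', hx', rfl⟩ h
    simp only [himage] at h
    obtain ⟨g, hg⟩ : Finset.univ.image x'.1 ∈ MulAction.orbit G (Finset.univ.image x.1) :=
      h ▸ MulAction.mem_orbit_self _
    set y := (monotoneAction K π hK hπ g).app (op (SimplexCategory.mk n)) x with hy
    have hy' : y ∈ (monotoneSSet K π).nonDegenerate n :=
      (app_mem_nonDegenerate_iff _ g x).2 hx
    have hyx : Finset.univ.image y.1 = Finset.univ.image x'.1 :=
      (image_monotoneAction g x).trans hg
    have hrange : Set.range (y.1 : Fin (n + 1) → ι) = Set.range (x'.1 : Fin (n + 1) → ι) := by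
      have h := congrArg (fun s : Finset ι => (s : Set ι)) hyx
      simp only [Finset.coe_image, Finset.coe_univ, Set.image_univ] at h
      exact h
    have hπy : (fun i : Fin (n + 1) => π (y.1 i)) = fun i : Fin (n + 1) => π (x'.1 i) := by
      refine (StrictMono.range_inj
        (strictMono_of_mem_nonDegenerate_monotoneSSet hdis hπ' hy')
        (strictMono_of_mem_nonDegenerate_monotoneSSet hdis hπ' hx')).1 ?_
      change Set.range (π ∘ y.1) = Set.range (π ∘ x'.1)
      rw [Set.range_comp, Set.range_comp]
      exact congrArg _ hrange
    have hyeq : y = x' := Subtype.ext (funext fun i => injOn_face hdis hπ' x'.2.1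
      (hyx ▸ Finset.mem_image_of_mem _ (Finset.mem_univ i))
      (Finset.mem_image_of_mem _ (Finset.mem_univ i)) (congrFun hπy i))
    rw [← hyeq]
    let _ := simplexAction (monotoneAction K π hK hπ) n
    exact (MulAction.orbit_smul g x).symm

variable [Finite G] {V : Type v} [AddCommGroup V] [Module ℝ V] [TopologicalSpace V]
  [IsTopologicalAddGroup V] [ContinuousSMul ℝ V] [T2Space V] [FiniteDimensional ℝ V]
  {ρ : Representation ℝ G V}

/-- The lower bound for simplicial complexes. -/
theorem two_pow_le_encard_of_complex {n : ℕ} (hn : Module.finrank ℝ V = n)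
    (hdis : ∀ s ∈ K, ∀ g : G, g ≠ 1 → Disjoint s (g • s))
    (he : EulerClassNonzero ρ (orderedAction K hK) n) :
    (2 ^ n : ℕ∞) ≤
      {O : Set (Finset ι) | ∃ s ∈ K, s.card = n + 1 ∧ O = MulAction.orbit G s}.encard := by
  by_contra! hlt
  -- Any linear order on the vertex orbits will do; a well-ordering supplies one.
  let _ : LinearOrder (MulAction.orbitRel.Quotient G ι) :=
    IsWellOrder.linearOrder WellOrderingRel
  let π : ι → MulAction.orbitRel.Quotient G ι := Quotient.mk _
  have hπ : ∀ (g : G) v, π (g • v) = π v := fun g v => Quotient.sound ⟨g, rfl⟩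
  have hπ' : ∀ v v', π v = π v' → ∃ g : G, g • v = v' := fun v v' h =>
    MulAction.orbitRel_apply.1 (Quotient.exact h.symm)
  have hone : ∀ {k : ℕ} (x : (monotoneSSet K π).obj (op (SimplexCategory.mk k))) (g : G)
      (i j : Fin (k + 1)), (monotoneAction K π hK hπ g).app (op (SimplexCategory.mk 0))
        (simplexVertex x i) = simplexVertex x j → g = 1 := by
    intro k x g i j h
    exact eq_one_of_smul_mem_face hdis x.2.1 (Finset.mem_image_of_mem _ (Finset.mem_univ i))
      (Finset.mem_image_of_mem _ (Finset.mem_univ j))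
      (congrFun (congrArg Subtype.val h) (0 : Fin 1))
  refine not_eulerClassNonzero_of_forall_mem (fun f => ?_) he
  refine mem_equivCoboundaries_of_restrictMonotone K π hK hπ f.eulerCochain f.eulerCocycle.2 ?_
  refine eulerCocycle_mem_equivCoboundaries hn ?_ ?_ (fun x _ => hone x)
    ((encard_orbits_monotoneSSet_le hdis hπ' n).trans_lt hlt)
    (f.restrictMonotone K π hK hπ)
  · intro v g hv
    refine hone v g 0 0 ?_
    rw [← simplexVertex_app, hv]
  · intro x hx i j hij
    exact injective_of_mem_nonDegenerate_monotoneSSet hdis hπ' hx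
      (congrFun (congrArg Subtype.val hij) (0 : Fin 1))

end LowerBound

end EquivariantEuler

end

theorem theorem1 {G : Type w} [Group G] [Finite G]
    {V : Type v} [AddCommGroup V] [Module ℝ V] [TopologicalSpace V] [IsTopologicalAddGroup V]
    [ContinuousSMul ℝ V] [T2Space V] [FiniteDimensional ℝ V]
    (ρ : Representation ℝ G V) (n : ℕ) (hn : Module.finrank ℝ V = n) :
    -- simplicial complexes
    (∀ (ι : Type u) [DecidableEq ι] [MulAction G ι] (K : AbstractSimplicialComplex ι)
      (hK : ∀ (g : G), ∀ s ∈ K, g • s ∈ K),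
      (∀ s ∈ K, ∀ g : G, g ≠ 1 → Disjoint s (g • s)) →
      EquivariantEuler.EulerClassNonzero ρ (EquivariantEuler.orderedAction K hK) n →
      (2 ^ n : ℕ∞) ≤
        {O : Set (Finset ι) | ∃ s ∈ K, s.card = n + 1 ∧ O = MulAction.orbit G s}.encard) ∧
    -- regular simplicial sets
    (∀ (X : SSet.{u}) [X.Nonsingular] (a : G →* End X),
      (∀ (k : ℕ), ∀ x ∈ X.nonDegenerate k, ∀ g : G, g ≠ 1 →
        SSet.Subcomplex.ofSimplex x ⊓ SSet.Subcomplex.ofSimplex ((a g).app (op (SimplexCategory.mk k)) x) = ⊥) →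
      EquivariantEuler.EulerClassNonzero ρ a n →
      (2 ^ n : ℕ∞) ≤
        {O : Set (X.obj (op (SimplexCategory.mk n))) | ∃ x ∈ X.nonDegenerate n,
          O = Set.range fun g : G => (a g).app (op (SimplexCategory.mk n)) x}.encard) := by
  refine ⟨fun ι _ _ K hK hdis he => ?_, fun X _ a hX he => ?_⟩
  · exact EquivariantEuler.two_pow_le_encard_of_complex hn hdis he
  · exact EquivariantEuler.two_pow_le_encard_of_nonsingular hn hX he
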